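/- Notation. $\mathcal H^d$ is $d$-dimensional Hausdorff measure on $\mathbb R^n$ (integer $0\le d\le n$), normalized to agree with Lebesgue measure on $\mathbb R^d$; $B(x,r)$ and $\overline B(x,r)$ are open and closed Euclidean balls. A gauge function is a nondecreasing $h:(0,+\infty)\to[0,+\infty]$ with $\lim_{r\to0^+}h(r)=0$. Let $U\subset\mathbb R^n$ be open and let $E\subset U$ be closed in $U$, with $\mathcal H^d(E\cap K)<+\infty$ for every compact $K\subset U$. A deformation for $E$ in a closed ball $B$ is a family $\{\varphi_t\}_{0\le t\le1}$ of maps $E\to\mathbb R^n$ such that $(x,t)\mapsto\varphi_t(x)$ is continuous on $E\times[0,1]$, $\varphi_0(x)=x$ for $x\in E$, $\varphi_t(x)=x$ for $x\in E\setminus B$ and $0\le t\le1$, $\varphi_t(E\cap B)\subset B$ for $0\le t\le1$, and $\varphi_1$ is Lipschitz. $E$ is a plain almost minimal set of dimension $d$ in $U$ with gauge function $h$ if $$\mathcal H^d(E\cap B)\le\mathcal H^d(\varphi_1(E)\cap B)+h(r)r^d$$ for every closed ball $B=\overline B(x,r)\subset U$, $r>0$, and every deformation $\{\varphi_t\}$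 for $E$ in $B$. $E$ is coral if $\mathcal H^d(E\cap B(x,r))>0$ for all $x\in E$ and $r>0$. Theorem 4.2 (Local Ahlfors regularity). Let $n\ge0$. (i) For every gauge function $h$ there is a constant $C\ge1$, depending only on $n$ and $h$, such that for every integer $0\le d\le n$, every open $U\subset\mathbb R^n$ and every coral plain almost minimal set $E$ of dimension $d$ in $U$ with gauge function $h$, $$C^{-1}r^d\le\mathcal H^d(E\cap B(x,r))\le C\,r^d\qquad(\ast)$$ whenever $x\in E$ and $r\in(0,1)$ are such that $B(x,2r)\subset U$. (ii) There are constants $C\ge1$ and $\varepsilon>0$, depending only on $n$, such that for every gauge function $h$, every integer $0\le d\le n$, every open $U\subset\mathbb R^n$ and every coral plain almost minimal set $E$ of dimension $d$ in $U$ with gauge function $h$, $(\ast)$ holds whenever $x\in E$ and $r\in(0,1)$ are such that $B(x,2r)\subset U$ and $h(r)\le\varepsilon$. -/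

import Mathlib

open Set Filter Topology MeasureTheory
open scoped ENNReal

/-- A gauge function `h : (0, ∞) → [0, ∞]`: nondecreasing on `(0, ∞)`, with limit `0` at `0⁺`.
Only the values on `(0, ∞)` matter. -/
structure IsGauge (h : ℝ → ℝ≥0∞) : Prop where
  monotoneOn : MonotoneOn h (Ioi 0)
  tendsto_zero : Tendsto h (𝓝[>] 0) (𝓝 0)

/-- `φ` (with `φ t y` standing for `φ_t(y)`; only the values for `t ∈ [0, 1]`, `y ∈ E` matter) is a
sliding deformation for `E` in the closed ball `B`, with respect to the sliding boundary `Γ`. -/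
structure IsSlidingDeformation {n : ℕ} (Γ E B : Set (EuclideanSpace ℝ (Fin n)))
    (φ : ℝ → EuclideanSpace ℝ (Fin n) → EuclideanSpace ℝ (Fin n)) : Prop where
  continuousOn : ContinuousOn
    (fun p : EuclideanSpace ℝ (Fin n) × ℝ => φ p.2 p.1) (E ×ˢ Icc (0 : ℝ) 1)
  map_zero : ∀ y ∈ E, φ 0 y = y
  eq_outside : ∀ y ∈ E \ B, ∀ t ∈ Icc (0 : ℝ) 1, φ t y = y
  mapsTo_ball : ∀ t ∈ Icc (0 : ℝ) 1, φ t '' (E ∩ B) ⊆ B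
  sliding : ∀ y ∈ E ∩ Γ, ∀ t ∈ Icc (0 : ℝ) 1, φ t y ∈ Γ
  lipschitz : ∃ K, LipschitzOnWith K (φ 1) E

/-- `F` is a sliding competitor for `E` in `B`: the final image `φ_1(E)` of a sliding
deformation for `E` in `B`. -/
def IsSlidingCompetitor {n : ℕ} (Γ E B F : Set (EuclideanSpace ℝ (Fin n))) : Prop :=
  ∃ φ : ℝ → EuclideanSpace ℝ (Fin n) → EuclideanSpace ℝ (Fin n),
    IsSlidingDeformation Γ E B φ ∧ F = φ 1 '' E

/-- `E` is a `d`-dimensional sliding almost minimal set in the open set `U`, with sliding boundary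
`Γ` and gauge function `h`. The set `E` is contained in `U`, closed in `U`, and has locally finite
`d`-dimensional Hausdorff measure in `U`; `μHE[d]` is the Hausdorff measure normalized so as to
coincide with Lebesgue measure on `ℝ^d`. -/
structure IsSlidingAlmostMinimal {n : ℕ} (d : ℕ) (h : ℝ → ℝ≥0∞)
    (Γ U E : Set (EuclideanSpace ℝ (Fin n))) : Prop where
  subset : E ⊆ U
  closed_in : ∃ A : Set (EuclideanSpace ℝ (Fin n)), IsClosed A ∧ E = A ∩ U
  locally_finite : ∀ K : Set (EuclideanSpace ℝ (Fin n)), IsCompact K → K ⊆ U → μHE[d] (E ∩ K) < ∞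
  almost_minimal : ∀ (x : EuclideanSpace ℝ (Fin n)) (r : ℝ), 0 < r → Metric.closedBall x r ⊆ U →
    ∀ F : Set (EuclideanSpace ℝ (Fin n)), IsSlidingCompetitor Γ E (Metric.closedBall x r) F →
      μHE[d] (E ∩ Metric.closedBall x r) ≤
        μHE[d] (F ∩ Metric.closedBall x r) + h r * ENNReal.ofReal (r ^ d)

/-- Plain almost minimal sets: no sliding boundary condition, that is, `Γ = ℝ^n`. -/
def IsPlainAlmostMinimal {n : ℕ} (d : ℕ) (h : ℝ → ℝ≥0∞)
    (U E : Set (EuclideanSpace ℝ (Fin n))) : Prop :=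
  IsSlidingAlmostMinimal d h univ U E

/-- The core `E^*` of `E`: the closed support (in `E`) of the restriction to `E` of the
`d`-dimensional Hausdorff measure. -/
def coralCore {n : ℕ} (d : ℕ) (E : Set (EuclideanSpace ℝ (Fin n))) :
    Set (EuclideanSpace ℝ (Fin n)) :=
  {x | x ∈ E ∧ ∀ r : ℝ, 0 < r → 0 < μHE[d] (E ∩ Metric.ball x r)}

/-- `E` is coral (or reduced) when `E = E^*`. -/
def IsCoral {n : ℕ} (d : ℕ) (E : Set (EuclideanSpace ℝ (Fin n))) : Prop :=
  E = coralCore d E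

/-!
Write a point in the coordinates of a translated grid of mesh `δ`. Let `dualDist d y` be the sup
distance from `y` to the dual skeleton of codimension `d + 1` (the points with at least `d + 1`
half-integer coordinates). In each unit cell, expand about its centre by the factor `1 / (2 m)` and
truncate to the cell: this `push` is the identity for `m = 1/2`, it sends `y` into the `d`-skeleton
of the grid as soon as `m ≤ dualDist d y`, and it is Lipschitz jointly in `m` and `y` with constant
of order `1 / m`. All the competitors are pushes with a parameter `m` depending on the point,
joined to the identity by straight lines.

This is a Federer-Fleming projection with a single random choice, the translate `a` of the grid.
The dual skeleton has codimension `d + 1`, so `dualDist d ^ (-d)` is integrable, and for some `a`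
the push onto the `d`-skeleton multiplies the `d`-measure of a prescribed part of the set by at
most a constant (`exists_good_translate`). Almost every `a` makes the set avoid this dual skeleton.
Moreover the translates for which the set meets the dual skeleton of codimension `d` have small
volume when the set has small `d`-measure at scale `δ` (`volume_exists_dualDist_eq_zero_le`).

For the upper bound, push onto the `d`-skeleton in a ball, letting `m` increase to `1/2` in an
annulus whose width is comparable with `δ` (`measure_le_skeleton_add`). The measure in the inner
ball is then at most that of the skeleton, plus a constant times the measure in the annulus, plus
the gauge term. Hole filling over a sequence of radii with geometrically decreasing gaps
(`exists_iteration_bound`) absorbs the annulus term.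

For the lower bound, suppose that the `d`-measure at scale `r` is small. Then the set can be pushed
onto the `(d - 1)`-skeleton, which is negligible. This stronger push has an expansion factor that
is not integrable, so it is used only on the `d`-faces whose stars meet the inner ball
(`pushParam`); the transition costs nothing, because on the boundary of a `d`-face the two pushes
agree. Hence small density passes to half the radius (`exists_density_decay`), thus to all smaller
scales around all nearby points of the set, and a covering argument shows that the set is
negligible there (`hausdorffMeasure_eq_zero_of_density_le`), against coralness.

Both bounds need the gauge to be small only at one scale comparable with `r`; a covering by
boundedly many smaller balls then gives both statements.
-/


/-! ### The one-dimensional push -/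

/-- The distance from `s` to the set `ℤ + 1/2` of half-integers. -/
noncomputable def halfDist (s : ℝ) : ℝ := 1 / 2 - |s - round s|

lemma halfDist_nonneg (s : ℝ) : 0 ≤ halfDist s := by
  have := abs_sub_round s
  unfold halfDist; linarith

lemma halfDist_le_half (s : ℝ) : halfDist s ≤ 1 / 2 := by
  have := abs_nonneg (s - round s)
  unfold halfDist; linarith

lemma half_sub_le_halfDist (s : ℝ) (k : ℤ) : 1 / 2 - |s - k| ≤ halfDist s := by
  have := round_le s k
  unfold halfDist; linarith

lemma halfDist_le_abs (s : ℝ) (k : ℤ) : halfDist s ≤ |s - k - 1 / 2| := by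
  -- `round s` is an integer, hence at distance at least `1 / 2` from `k + 1 / 2`
  have h : (1 / 2 : ℝ) ≤ |(round s : ℝ) - k - 1 / 2| := by
    rcases le_or_gt (round s) k with h | h
    · have : (round s : ℝ) ≤ k := by exact_mod_cast h
      rw [abs_of_nonpos (by linarith)]; linarith
    · have : (k : ℝ) + 1 ≤ round s := by exact_mod_cast h
      rw [abs_of_nonneg (by linarith)]; linarith
  have h2 := abs_add_le ((round s : ℝ) - s) (s - k - 1 / 2)
  rw [abs_sub_comm (round s : ℝ) s] at h2
  have h3 : (round s : ℝ) - s + (s - k - 1 / 2) = (round s : ℝ) - k - 1 / 2 := by ring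
  rw [h3] at h2
  unfold halfDist; linarith

lemma halfDist_le_add (s t : ℝ) : halfDist s ≤ halfDist t + |s - t| := by
  have h := half_sub_le_halfDist t (round s)
  have h2 := abs_sub_le t s (round s)
  rw [abs_sub_comm t s] at h2
  unfold halfDist at *; linarith

lemma halfDist_eq_abs_floor (s : ℝ) : halfDist s = |s - ⌊s⌋ - 1 / 2| := by
  apply le_antisymm (halfDist_le_abs s _)
  have h1 := Int.floor_le s
  have h2 := Int.lt_floor_add_one s
  rcases le_total (s - ⌊s⌋) (1 / 2) with h | h
  · have := half_sub_le_halfDist s ⌊s⌋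
    rw [abs_of_nonneg (by linarith)] at this
    rw [abs_of_nonpos (by linarith)]; linarith
  · have := half_sub_le_halfDist s (⌊s⌋ + 1)
    push_cast at this
    rw [abs_of_nonpos (by linarith)] at this
    rw [abs_of_nonneg (by linarith)]; linarith

/-- The truncation of a real number to the interval `[-1/2, 1/2]`. -/
noncomputable def clampHalf (v : ℝ) : ℝ := max (-(1 / 2)) (min (1 / 2) v)

lemma clampHalf_le (v : ℝ) : clampHalf v ≤ 1 / 2 := by
  unfold clampHalf; exact max_le (by norm_num) (min_le_left _ _)

lemma neg_half_le_clampHalf (v : ℝ) : -(1 / 2) ≤ clampHalf v := le_max_left _ _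

lemma clampHalf_of_mem {v : ℝ} (h : |v| ≤ 1 / 2) : clampHalf v = v := by
  rw [abs_le] at h
  unfold clampHalf
  rw [min_eq_right h.2, max_eq_right h.1]

lemma clampHalf_of_ge {v : ℝ} (h : 1 / 2 ≤ v) : clampHalf v = 1 / 2 := by
  unfold clampHalf
  rw [min_eq_left h, max_eq_right (by norm_num)]

lemma clampHalf_of_le {v : ℝ} (h : v ≤ -(1 / 2)) : clampHalf v = -(1 / 2) := by
  unfold clampHalf
  rw [min_eq_right (by linarith), max_eq_left h]

lemma abs_clampHalf_sub_le (v w : ℝ) : |clampHalf v - clampHalf w| ≤ |v - w| := by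
  unfold clampHalf
  calc _ ≤ |min (1 / 2) v - min (1 / 2) w| := by
        simpa using abs_max_sub_max_le_max (-(1 / 2) : ℝ) (min (1 / 2) v) (-(1 / 2)) (min (1 / 2) w)
    _ ≤ _ := by simpa using abs_min_sub_min_le_max (1 / 2 : ℝ) v (1 / 2) w

/-- The push with parameter `m`: in each unit cell `[k, k + 1]`, expand by the factor `1 / (2 m)`
about the midpoint `k + 1/2`, and truncate to the cell. For `m = 1/2` this is the identity; for
`m ≤ halfDist s` the point `s` is sent to an end point of its cell. -/
noncomputable def push (m s : ℝ) : ℝ := ⌊s⌋ + 1 / 2 + clampHalf ((s - ⌊s⌋ - 1 / 2) / (2 * m))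

lemma push_half (s : ℝ) : push (1 / 2) s = s := by
  have h1 := Int.floor_le s
  have h2 := Int.lt_floor_add_one s
  unfold push
  rw [clampHalf_of_mem]
  · ring
  · rw [abs_le]; constructor <;> linarith

lemma floor_le_push (m s : ℝ) : ⌊s⌋ ≤ push m s := by
  have := neg_half_le_clampHalf ((s - ⌊s⌋ - 1 / 2) / (2 * m))
  unfold push; linarith

lemma push_le_floor_add_one (m s : ℝ) : push m s ≤ ⌊s⌋ + 1 := by
  have := clampHalf_le ((s - ⌊s⌋ - 1 / 2) / (2 * m))
  unfold push; linarith

lemma abs_push_sub_self_le (m s : ℝ) : |push m s - s| ≤ 1 := by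
  have h1 := Int.floor_le s
  have h2 := Int.lt_floor_add_one s
  have h3 := floor_le_push m s
  have h4 := push_le_floor_add_one m s
  rw [abs_le]; constructor <;> linarith

lemma push_mem_range_of_le {m s : ℝ} (hm : 0 < m) (h : m ≤ halfDist s) :
    push m s ∈ range ((↑) : ℤ → ℝ) := by
  rw [halfDist_eq_abs_floor] at h
  unfold push
  rcases le_total 0 (s - ⌊s⌋ - 1 / 2) with h0 | h0
  · rw [abs_of_nonneg h0] at h
    rw [clampHalf_of_ge]
    · exact ⟨⌊s⌋ + 1, by push_cast; ring⟩
    · rw [le_div_iff₀ (by linarith)]; linarith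
  · rw [abs_of_nonpos h0] at h
    rw [clampHalf_of_le]
    · exact ⟨⌊s⌋, by ring⟩
    · rw [div_le_iff₀ (by linarith)]; linarith

lemma push_sub_floor_le {m s : ℝ} (hm : 0 < m) (hm2 : m ≤ 1 / 2) :
    push m s - ⌊s⌋ ≤ (s - ⌊s⌋) / (2 * m) := by
  have h1 := Int.floor_le s
  have h2 : (1 / 2 : ℝ) ≤ 1 / 2 / (2 * m) := by
    rw [le_div_iff₀ (by linarith)]; linarith
  have h3 : (0 : ℝ) ≤ (s - ⌊s⌋) / (2 * m) := div_nonneg (by linarith) (by linarith)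
  have h4 : (s - ⌊s⌋ - 1 / 2) / (2 * m) = (s - ⌊s⌋) / (2 * m) - 1 / 2 / (2 * m) := by
    rw [sub_div]
  have h5 : clampHalf ((s - ⌊s⌋ - 1 / 2) / (2 * m)) ≤ (s - ⌊s⌋) / (2 * m) - 1 / 2 := by
    unfold clampHalf
    refine max_le (by linarith) ((min_le_right _ _).trans (by linarith))
  unfold push; linarith

lemma floor_add_one_sub_push_le {m s : ℝ} (hm : 0 < m) (hm2 : m ≤ 1 / 2) :
    ⌊s⌋ + 1 - push m s ≤ (⌊s⌋ + 1 - s) / (2 * m) := by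
  have h1 := Int.lt_floor_add_one s
  have h2 : (1 / 2 : ℝ) ≤ 1 / 2 / (2 * m) := by
    rw [le_div_iff₀ (by linarith)]; linarith
  have h3 : (0 : ℝ) ≤ (⌊s⌋ + 1 - s) / (2 * m) := div_nonneg (by linarith) (by linarith)
  have h4 : (s - ⌊s⌋ - 1 / 2) / (2 * m) = 1 / 2 / (2 * m) - (⌊s⌋ + 1 - s) / (2 * m) := by
    rw [← sub_div]; congr 1; ring
  have h5 : 1 / 2 - (⌊s⌋ + 1 - s) / (2 * m) ≤ clampHalf ((s - ⌊s⌋ - 1 / 2) / (2 * m)) := by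
    unfold clampHalf
    refine le_max_of_le_right (le_min (by linarith) (by linarith))
  unfold push; linarith

lemma abs_clampHalf_div_sub_le {m m' v v' : ℝ} (hm : 0 < m) (hmm : m ≤ m') :
    |clampHalf (v / (2 * m)) - clampHalf (v' / (2 * m'))| ≤ (|v - v'| + |m - m'|) / (2 * m) := by
  have hm' : 0 < m' := hm.trans_le hmm
  have h1 : |clampHalf (v / (2 * m)) - clampHalf (v' / (2 * m))| ≤ |v - v'| / (2 * m) := by
    refine (abs_clampHalf_sub_le _ _).trans_eq ?_
    rw [← sub_div, abs_div, abs_of_pos (show 0 < 2 * m by linarith)]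
  have h2 : |clampHalf (v' / (2 * m)) - clampHalf (v' / (2 * m'))| ≤ |m - m'| / (2 * m) := by
    rcases le_total |v'| m' with h | h
    · refine (abs_clampHalf_sub_le _ _).trans ?_
      have e : v' / (2 * m) - v' / (2 * m') = (v' / m') * ((m' - m) / (2 * m)) := by
        field_simp
      rw [e, abs_mul, abs_div, abs_of_pos hm', abs_div, abs_of_pos (show 0 < 2 * m by linarith),
        abs_sub_comm m' m]
      refine mul_le_of_le_one_left (by positivity) ?_
      rw [div_le_one hm']; exact h
    · have hz : clampHalf (v' / (2 * m)) - clampHalf (v' / (2 * m')) = 0 := by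
        rcases le_total 0 v' with h0 | h0
        · rw [abs_of_nonneg h0] at h
          rw [clampHalf_of_ge, clampHalf_of_ge, sub_self]
          · rw [le_div_iff₀ (by linarith)]; linarith
          · rw [le_div_iff₀ (by linarith)]; linarith
        · rw [abs_of_nonpos h0] at h
          rw [clampHalf_of_le, clampHalf_of_le, sub_self]
          · rw [div_le_iff₀ (by linarith)]; linarith
          · rw [div_le_iff₀ (by linarith)]; linarith
      rw [hz, abs_zero]; positivity
  have h3 := abs_sub_le (clampHalf (v / (2 * m))) (clampHalf (v' / (2 * m)))
    (clampHalf (v' / (2 * m')))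
  rw [add_div]; linarith

lemma push_sub_push_le_of_floor_lt {c m m' s s' : ℝ} (hc : 0 < c) (hm : c ≤ m) (hm2 : m ≤ 1 / 2)
    (hm' : c ≤ m') (hm2' : m' ≤ 1 / 2) (h : ⌊s⌋ < ⌊s'⌋) :
    |push m s - push m' s'| ≤ |s - s'| / (2 * c) := by
  have hk : (⌊s⌋ : ℝ) + 1 ≤ ⌊s'⌋ := by exact_mod_cast h
  have a1 := Int.lt_floor_add_one s
  have a2 := Int.floor_le s'
  have a3 := push_le_floor_add_one m s
  have a4 := floor_le_push m' s'
  have b1 : (⌊s⌋ : ℝ) + 1 - push m s ≤ (⌊s⌋ + 1 - s) / (2 * c) :=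
    (floor_add_one_sub_push_le (hc.trans_le hm) hm2).trans
      (div_le_div_of_nonneg_left (by linarith) (by linarith) (by linarith))
  have b2 : push m' s' - ⌊s'⌋ ≤ (s' - ⌊s'⌋) / (2 * c) :=
    (push_sub_floor_le (hc.trans_le hm') hm2').trans
      (div_le_div_of_nonneg_left (by linarith) (by linarith) (by linarith))
  have b3 : (⌊s'⌋ : ℝ) - (⌊s⌋ + 1) ≤ (⌊s'⌋ - (⌊s⌋ + 1)) / (2 * c) := by
    rw [le_div_iff₀ (by linarith)]
    exact mul_le_of_le_one_right (by linarith) (by linarith)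
  rw [abs_of_nonpos (by linarith), abs_of_nonpos (by linarith)]
  have e : -(s - s') / (2 * c) = (⌊s⌋ + 1 - s) / (2 * c) + (s' - ⌊s'⌋) / (2 * c)
      + (⌊s'⌋ - (⌊s⌋ + 1)) / (2 * c) := by
    rw [← add_div, ← add_div]; congr 1; ring
  rw [e]; linarith

/-- The push is jointly Lipschitz in the parameter and the point, with a constant inversely
proportional to the parameter. -/
lemma abs_push_sub_push_le {c m m' s s' : ℝ} (hc : 0 < c) (hm : c ≤ m) (hm2 : m ≤ 1 / 2)
    (hm' : c ≤ m') (hm2' : m' ≤ 1 / 2) :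
    |push m s - push m' s'| ≤ (|s - s'| + |m - m'|) / (2 * c) := by
  have key : |s - s'| / (2 * c) ≤ (|s - s'| + |m - m'|) / (2 * c) := by
    gcongr; linarith [abs_nonneg (m - m')]
  rcases lt_trichotomy ⌊s⌋ ⌊s'⌋ with h | h | h
  · exact (push_sub_push_le_of_floor_lt hc hm hm2 hm' hm2' h).trans key
  · unfold push
    rw [h]
    have e : ∀ x y : ℝ, (⌊s'⌋ : ℝ) + 1 / 2 + x - (⌊s'⌋ + 1 / 2 + y) = x - y := by intros; ring
    have e2 : s - s' = (s - ⌊s'⌋ - 1 / 2) - (s' - ⌊s'⌋ - 1 / 2) := by ring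
    rw [e]
    rcases le_total m m' with hmm | hmm
    · refine (abs_clampHalf_div_sub_le (hc.trans_le hm) hmm).trans ?_
      rw [← e2]
      exact div_le_div_of_nonneg_left (by positivity) (by linarith) (by linarith)
    · rw [abs_sub_comm]
      refine (abs_clampHalf_div_sub_le (hc.trans_le hm') hmm).trans ?_
      rw [abs_sub_comm, ← e2, abs_sub_comm m' m]
      exact div_le_div_of_nonneg_left (by positivity) (by linarith) (by linarith)
  · rw [abs_sub_comm]
    refine (push_sub_push_le_of_floor_lt hc hm' hm2' hm hm2 h).trans ?_
    rw [abs_sub_comm s' s]; exact key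

/-! ### Distance to the dual skeleton -/

/-- The distance, in the sup norm and truncated at `1/2`, from `y` to the dual skeleton of
dimension `n - e - 1` of the unit grid, that is, to the set of points with at least `e + 1`
half-integer coordinates. It is the `(e + 1)`-st smallest of the numbers `halfDist (y i)`, or `1/2`
when `e ≥ n`; here it is encoded as the largest `t ≤ 1/2` for which at most `e` of these numbers are
less than `t`. -/
noncomputable def dualDist {n : ℕ} (e : ℕ) (y : Fin n → ℝ) : ℝ :=
  sSup {t : ℝ | 0 ≤ t ∧ t ≤ 1 / 2 ∧ (Finset.univ.filter fun i => halfDist (y i) < t).card ≤ e}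

section dualDist

variable {n : ℕ} {e : ℕ} {y z : Fin n → ℝ} {t : ℝ}

lemma dualDist_bddAbove (e : ℕ) (y : Fin n → ℝ) : BddAbove
    {t : ℝ | 0 ≤ t ∧ t ≤ 1 / 2 ∧ (Finset.univ.filter fun i => halfDist (y i) < t).card ≤ e} :=
  ⟨1 / 2, fun _ h => h.2.1⟩

lemma zero_mem_dualDist (e : ℕ) (y : Fin n → ℝ) : (0 : ℝ) ∈
    {t : ℝ | 0 ≤ t ∧ t ≤ 1 / 2 ∧ (Finset.univ.filter fun i => halfDist (y i) < t).card ≤ e} := by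
  refine ⟨le_rfl, by norm_num, ?_⟩
  rw [Finset.filter_false_of_mem]
  · simp
  · intro i _; exact not_lt.2 (halfDist_nonneg _)

lemma dualDist_nonneg (e : ℕ) (y : Fin n → ℝ) : 0 ≤ dualDist e y :=
  le_csSup (dualDist_bddAbove e y) (zero_mem_dualDist e y)

lemma dualDist_le_half (e : ℕ) (y : Fin n → ℝ) : dualDist e y ≤ 1 / 2 :=
  csSup_le ⟨0, zero_mem_dualDist e y⟩ fun _ h => h.2.1

lemma le_dualDist (ht : t ≤ 1 / 2)
    (h : (Finset.univ.filter fun i => halfDist (y i) < t).card ≤ e) : t ≤ dualDist e y := by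
  rcases le_total 0 t with h0 | h0
  · exact le_csSup (dualDist_bddAbove e y) ⟨h0, ht, h⟩
  · exact h0.trans (dualDist_nonneg e y)

lemma card_lt_dualDist_le (e : ℕ) (y : Fin n → ℝ) :
    (Finset.univ.filter fun i => halfDist (y i) < dualDist e y).card ≤ e := by
  -- by finiteness, some admissible `t` close to the supremum has the same set of small coordinates
  set F := Finset.univ.filter fun i => halfDist (y i) < dualDist e y with hF
  by_cases hne : F.Nonempty
  · obtain ⟨i, hi, hmax⟩ := F.exists_max_image (fun i => halfDist (y i)) hne
    have hi' : halfDist (y i) < dualDist e y := (Finset.mem_filter.1 hi).2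
    obtain ⟨t, ht, hit⟩ := exists_lt_of_lt_csSup ⟨0, zero_mem_dualDist e y⟩ hi'
    refine (Finset.card_le_card ?_).trans ht.2.2
    intro j hj
    exact Finset.mem_filter.2 ⟨Finset.mem_univ _, (hmax j hj).trans_lt hit⟩
  · rw [Finset.not_nonempty_iff_eq_empty.1 hne]; simp

lemma dualDist_le_add_dist (e : ℕ) (y z : Fin n → ℝ) :
    dualDist e y ≤ dualDist e z + dist y z := by
  have h : dualDist e y - dist y z ≤ dualDist e z := by
    refine le_dualDist ?_ ?_
    · linarith [dualDist_le_half e y, dist_nonneg (x := y) (y := z)]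
    · refine (Finset.card_le_card ?_).trans (card_lt_dualDist_le e y)
      intro i hi
      have hi := (Finset.mem_filter.1 hi).2
      refine Finset.mem_filter.2 ⟨Finset.mem_univ _, ?_⟩
      have h1 := halfDist_le_add (y i) (z i)
      have h2 := dist_le_pi_dist y z i
      rw [Real.dist_eq] at h2
      linarith
  linarith

lemma lipschitzWith_dualDist (e : ℕ) : LipschitzWith 1 (dualDist e : (Fin n → ℝ) → ℝ) :=
  LipschitzWith.of_le_add fun y z => dualDist_le_add_dist e y z

lemma dualDist_mono {e e' : ℕ} (h : e ≤ e') (y : Fin n → ℝ) : dualDist e y ≤ dualDist e' y :=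
  le_dualDist (dualDist_le_half e y) ((card_lt_dualDist_le e y).trans h)

lemma lt_card_of_dualDist_le (ht : t < 1 / 2) (h : dualDist e y ≤ t) :
    e < (Finset.univ.filter fun i => halfDist (y i) ≤ t).card := by
  by_contra! hc
  -- a threshold `t' > t` below all the coordinates that exceed `t`
  obtain ⟨t', ht', htt, hall⟩ : ∃ t' : ℝ, t' ≤ 1 / 2 ∧ t < t' ∧
      ∀ i, t < halfDist (y i) → t' ≤ halfDist (y i) := by
    set F := Finset.univ.filter fun i => t < halfDist (y i) with hF
    by_cases hne : F.Nonempty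
    · obtain ⟨i, hi, hmin⟩ := F.exists_min_image (fun i => halfDist (y i)) hne
      refine ⟨halfDist (y i), halfDist_le_half _, (Finset.mem_filter.1 hi).2, fun j hj => ?_⟩
      exact hmin j (Finset.mem_filter.2 ⟨Finset.mem_univ _, hj⟩)
    · refine ⟨1 / 2, le_rfl, ht, fun j hj => ?_⟩
      exact absurd ⟨j, Finset.mem_filter.2 ⟨Finset.mem_univ _, hj⟩⟩ hne
  have : t' ≤ dualDist e y := by
    refine le_dualDist ht' ((Finset.card_le_card ?_).trans hc)
    intro i hi
    have hi := (Finset.mem_filter.1 hi).2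
    refine Finset.mem_filter.2 ⟨Finset.mem_univ _, ?_⟩
    by_contra! h3
    linarith [hall i h3]
  linarith

end dualDist

/-! ### The skeleton and the pushing map -/

/-- The `e`-skeleton of the unit grid: the points with at most `e` non-integer coordinates. -/
def skeleton (n e : ℕ) : Set (Fin n → ℝ) :=
  {y | ∃ I : Finset (Fin n), I.card ≤ e ∧ ∀ i ∉ I, y i ∈ range ((↑) : ℤ → ℝ)}

lemma push_mem_skeleton {n e : ℕ} {y : Fin n → ℝ} {m : ℝ} (hm : 0 < m) (h : m ≤ dualDist e y) :
    (fun i => push m (y i)) ∈ skeleton n e := by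
  refine ⟨_, card_lt_dualDist_le e y, fun i hi => push_mem_range_of_le hm (h.trans ?_)⟩
  by_contra! hc
  exact hi (Finset.mem_filter.2 ⟨Finset.mem_univ _, hc⟩)

lemma dist_push_le {n : ℕ} {c m m' : ℝ} {y y' : Fin n → ℝ} (hc : 0 < c) (hm : c ≤ m)
    (hm2 : m ≤ 1 / 2) (hm' : c ≤ m') (hm2' : m' ≤ 1 / 2) :
    dist (fun i => push m (y i)) (fun i => push m' (y' i)) ≤
      (dist y y' + |m - m'|) / (2 * c) := by
  rw [dist_pi_le_iff (by positivity)]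
  intro i
  rw [Real.dist_eq]
  refine (abs_push_sub_push_le hc hm hm2 hm' hm2').trans ?_
  have := dist_le_pi_dist y y' i
  rw [Real.dist_eq] at this
  gcongr

/-! ### Stars of open faces -/

/-- The star of the open face with free directions `I` and base point `k`: the points `y` for which
the coordinates in `I` are closer to the half-integers `k i + 1/2` than the other coordinates are
to any half-integer, where moreover each `y i` with `i ∉ I` is within `1/2` of the integer `k i`.
When `I.card = d`, the map `push (dualDist d y)` sends `y` into that open face. -/
def faceStar {n : ℕ} (I : Finset (Fin n)) (k : Fin n → ℤ) : Set (Fin n → ℝ) :=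
  {y | ∃ α β : ℝ, 0 ≤ α ∧ α < β ∧ β ≤ 1 / 2 ∧ (∀ i ∈ I, |y i - k i - 1 / 2| ≤ α) ∧
    ∀ i ∉ I, |y i - k i| ≤ 1 / 2 - β}

section faceStar

variable {n d : ℕ} {I : Finset (Fin n)} {k : Fin n → ℤ} {y z : Fin n → ℝ}

lemma faceStar_bounds (hI : I.card = d + 1) (hy : y ∈ faceStar I k) :
    (∀ i ∈ I, |y i - k i - 1 / 2| ≤ dualDist d y) ∧
      (∀ i ∉ I, |y i - k i| ≤ 1 / 2 - dualDist (d + 1) y) ∧ dualDist d y < dualDist (d + 1) y := by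
  obtain ⟨α, β, hα, hαβ, hβ, h1, h2⟩ := hy
  have w1 : ∀ i ∈ I, halfDist (y i) = |y i - k i - 1 / 2| := by
    intro i hi
    apply le_antisymm (halfDist_le_abs _ _)
    have := h1 i hi
    rw [abs_le] at this
    rcases le_total 0 (y i - k i - 1 / 2) with h | h
    · have h3 := half_sub_le_halfDist (y i) (k i + 1)
      push_cast at h3
      rw [abs_of_nonpos (by linarith)] at h3
      rw [abs_of_nonneg h]; linarith
    · have h3 := half_sub_le_halfDist (y i) (k i)
      rw [abs_of_nonneg (by linarith)] at h3
      rw [abs_of_nonpos h]; linarith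
  have w2 : ∀ i ∉ I, halfDist (y i) = 1 / 2 - |y i - k i| := by
    intro i hi
    refine le_antisymm ?_ (half_sub_le_halfDist _ _)
    have := h2 i hi
    rw [abs_le] at this
    rcases le_total 0 (y i - k i) with h | h
    · have h3 := halfDist_le_abs (y i) (k i)
      rw [abs_of_nonpos (by linarith)] at h3
      rw [abs_of_nonneg h]; linarith
    · have h3 := halfDist_le_abs (y i) (k i - 1)
      push_cast at h3
      rw [abs_of_nonneg (by linarith)] at h3
      rw [abs_of_nonpos h]; linarith
  have b1 : β ≤ dualDist (d + 1) y := by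
    refine le_dualDist hβ ((Finset.card_le_card ?_).trans hI.le)
    intro i hi
    have hi := (Finset.mem_filter.1 hi).2
    by_contra hc
    have := h2 i hc
    rw [w2 i hc] at hi; linarith
  have b2 : dualDist d y ≤ α := by
    by_contra! hc
    have : I.card ≤ d := by
      refine (Finset.card_le_card ?_).trans (card_lt_dualDist_le d y)
      intro i hi
      refine Finset.mem_filter.2 ⟨Finset.mem_univ _, ?_⟩
      rw [w1 i hi]; exact (h1 i hi).trans_lt hc
    omega
  refine ⟨fun i hi => ?_, fun i hi => ?_, by linarith⟩
  · rw [← w1 i hi]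
    by_contra! hc
    -- `min (halfDist (y i)) β` would be an admissible threshold
    have : min (halfDist (y i)) β ≤ dualDist d y := by
      refine le_dualDist ((min_le_right _ _).trans hβ) ?_
      have : (I.erase i).card = d := by rw [Finset.card_erase_of_mem hi, hI]; rfl
      refine (Finset.card_le_card ?_).trans this.le
      intro j hj
      have hj := (Finset.mem_filter.1 hj).2
      refine Finset.mem_erase.2 ⟨?_, ?_⟩
      · rintro rfl; exact absurd (hj.trans_le (min_le_left _ _)) (lt_irrefl _)
      · by_contra hjI
        have h3 := h2 j hjI
        have h4 := hj.trans_le (min_le_right _ _)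
        rw [w2 j hjI] at h4; linarith
    rcases min_le_iff.1 this with h | h <;> linarith
  · have : dualDist (d + 1) y ≤ halfDist (y i) := by
      by_contra! hc
      have : (insert i I).card ≤ d + 1 := by
        refine (Finset.card_le_card ?_).trans (card_lt_dualDist_le (d + 1) y)
        intro j hj
        refine Finset.mem_filter.2 ⟨Finset.mem_univ _, ?_⟩
        rcases Finset.mem_insert.1 hj with rfl | hj
        · exact hc
        · rw [w1 j hj]; linarith [h1 j hj]
      rw [Finset.card_insert_of_notMem hi] at this; omega
    rw [w2 i hi] at this; linarith

/-- Stars are stable under displacements smaller than half the gap between the two consecutive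
order statistics. -/
lemma mem_faceStar_of_dist_lt (hI : I.card = d + 1) (hy : y ∈ faceStar I k)
    (h : 2 * dist y z < dualDist (d + 1) y - dualDist d y) : z ∈ faceStar I k := by
  obtain ⟨h1, h2, -⟩ := faceStar_bounds hI hy
  have hd := dist_nonneg (x := y) (y := z)
  refine ⟨dualDist d y + dist y z, dualDist (d + 1) y - dist y z,
    by linarith [dualDist_nonneg d y], by linarith, by linarith [dualDist_le_half (d + 1) y],
    fun i hi => ?_, fun i hi => ?_⟩
  · have a := h1 i hi
    have b := dist_le_pi_dist y z i
    rw [Real.dist_eq, abs_le] at b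
    rw [abs_le] at a ⊢
    constructor <;> linarith
  · have a := h2 i hi
    have b := dist_le_pi_dist y z i
    rw [Real.dist_eq, abs_le] at b
    rw [abs_le] at a ⊢
    constructor <;> linarith

lemma dist_le_one_of_mem_faceStar (hy : y ∈ faceStar I k) (hz : z ∈ faceStar I k) :
    dist y z ≤ 1 := by
  obtain ⟨α, β, h0, h1, h2, h3, h4⟩ := hy
  obtain ⟨α', β', h0', h1', h2', h3', h4'⟩ := hz
  rw [dist_pi_le_iff zero_le_one]
  intro i
  rw [Real.dist_eq]
  by_cases hi : i ∈ I
  · have a := h3 i hi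
    have b := h3' i hi
    rw [abs_le] at a b ⊢
    constructor <;> linarith
  · have a := h4 i hi
    have b := h4' i hi
    rw [abs_le] at a b ⊢
    constructor <;> linarith

lemma exists_mem_faceStar (hgap : dualDist d y < dualDist (d + 1) y) :
    ∃ I : Finset (Fin n), ∃ k : Fin n → ℤ, I.card = d + 1 ∧ y ∈ faceStar I k := by
  have hd2 := dualDist_le_half (d + 1) y
  set I := Finset.univ.filter fun i => halfDist (y i) ≤ dualDist d y with hI
  have c1 : d < I.card := lt_card_of_dualDist_le (by linarith) le_rfl
  have c2 : I.card ≤ d + 1 := by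
    refine (Finset.card_le_card ?_).trans (card_lt_dualDist_le (d + 1) y)
    intro i hi
    exact Finset.mem_filter.2 ⟨Finset.mem_univ _, (Finset.mem_filter.1 hi).2.trans_lt hgap⟩
  have c3 : ∀ i ∉ I, dualDist (d + 1) y ≤ halfDist (y i) := by
    intro i hi
    by_contra! hc
    have : (insert i I).card ≤ d + 1 := by
      refine (Finset.card_le_card ?_).trans (card_lt_dualDist_le (d + 1) y)
      intro j hj
      refine Finset.mem_filter.2 ⟨Finset.mem_univ _, ?_⟩
      rcases Finset.mem_insert.1 hj with rfl | hj
      · exact hc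
      · exact (Finset.mem_filter.1 hj).2.trans_lt hgap
    rw [Finset.card_insert_of_notMem hi] at this; omega
  refine ⟨I, fun i => if i ∈ I then ⌊y i⌋ else round (y i), by omega, dualDist d y,
    dualDist (d + 1) y, dualDist_nonneg _ _, hgap, hd2, fun i hi => ?_, fun i hi => ?_⟩
  · simp only [hi, if_true]
    rw [← halfDist_eq_abs_floor]; exact (Finset.mem_filter.1 hi).2
  · simp only [hi, if_false]
    have := c3 i hi
    unfold halfDist at this; linarith

end faceStar

/-! ### Projecting one dimension further on selected faces -/

open Classical in
/-- The push parameter that projects to the `d`-skeleton on the faces whose star meets `D`, and only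
to the `(d + 1)`-skeleton elsewhere. -/
noncomputable def pushParam {n : ℕ} (d : ℕ) (D : Set (Fin n → ℝ)) (y : Fin n → ℝ) : ℝ :=
  if ∃ z ∈ D, ∃ I : Finset (Fin n), ∃ k : Fin n → ℤ, I.card = d + 1 ∧
    z ∈ faceStar I k ∧ y ∈ faceStar I k
  then dualDist d y else dualDist (d + 1) y

section pushParam

variable {n d : ℕ} {D : Set (Fin n → ℝ)} {y z : Fin n → ℝ}

lemma pushParam_eq_or (d : ℕ) (D : Set (Fin n → ℝ)) (y : Fin n → ℝ) :
    (pushParam d D y = dualDist d y ∧ ∃ z ∈ D, dist z y ≤ 1) ∨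
      pushParam d D y = dualDist (d + 1) y := by
  unfold pushParam
  split_ifs with h
  · obtain ⟨z, hz, I, k, -, h1, h2⟩ := h
    exact Or.inl ⟨rfl, z, hz, dist_le_one_of_mem_faceStar h1 h2⟩
  · exact Or.inr rfl

lemma dualDist_le_pushParam (d : ℕ) (D : Set (Fin n → ℝ)) (y : Fin n → ℝ) :
    dualDist d y ≤ pushParam d D y := by
  rcases pushParam_eq_or d D y with h | h
  · exact h.1.ge
  · rw [h]; exact dualDist_mono (Nat.le_succ d) y

lemma pushParam_le_half (d : ℕ) (D : Set (Fin n → ℝ)) (y : Fin n → ℝ) :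
    pushParam d D y ≤ 1 / 2 := by
  rcases pushParam_eq_or d D y with h | h
  · rw [h.1]; exact dualDist_le_half _ _
  · rw [h]; exact dualDist_le_half _ _

lemma pushParam_of_mem (hy : y ∈ D) : pushParam d D y = dualDist d y := by
  unfold pushParam
  split_ifs with h
  · rfl
  · refine le_antisymm ?_ (dualDist_mono (Nat.le_succ d) y)
    by_contra! hc
    obtain ⟨I, k, hI, hs⟩ := exists_mem_faceStar hc
    exact h ⟨y, hy, I, k, hI, hs, hs⟩

/-- If a selected star contains `y` but not `z`, then the gap between the two parameters at `y` is
at most twice the distance from `y` to `z`; so switching parameters costs only a constant. -/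
lemma pushParam_le_add (d : ℕ) (D : Set (Fin n → ℝ)) (y z : Fin n → ℝ) :
    pushParam d D y ≤ pushParam d D z + 3 * dist y z := by
  have h0 := dist_nonneg (x := y) (y := z)
  have a1 := dualDist_le_add_dist d y z
  have a2 := dualDist_le_add_dist (d + 1) y z
  have a3 := dualDist_mono (Nat.le_succ d) z
  have a4 := dualDist_le_add_dist (d + 1) y z
  unfold pushParam
  split_ifs with h h' h'
  · linarith
  · linarith
  · obtain ⟨w, hw, I, k, hI, h1, h2⟩ := h'
    by_cases hlt : 2 * dist z y < dualDist (d + 1) z - dualDist d z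
    · exact absurd ⟨w, hw, I, k, hI, h1, mem_faceStar_of_dist_lt hI h2 hlt⟩ h
    · rw [dist_comm z y] at hlt; linarith
  · linarith

end pushParam

/-! ### Volume of the neighbourhoods of the dual skeleton -/

lemma volume_halfDist_le (x t : ℝ) :
    volume {s : ℝ | s ∈ Icc (0 : ℝ) 1 ∧ halfDist (x + s) ≤ t} ≤ ENNReal.ofReal (4 * t) := by
  have hsub : {s : ℝ | s ∈ Icc (0 : ℝ) 1 ∧ halfDist (x + s) ≤ t} ⊆
      Metric.closedBall (⌊x⌋ + 1 / 2 - x) t ∪ Metric.closedBall (⌊x⌋ + 1 + 1 / 2 - x) t := by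
    rintro s ⟨⟨h0, h1⟩, hs⟩
    rw [halfDist_eq_abs_floor] at hs
    have f1 : ⌊x⌋ ≤ ⌊x + s⌋ := Int.floor_mono (by linarith)
    have f2 : ⌊x + s⌋ ≤ ⌊x⌋ + 1 := by
      rw [← Int.floor_add_one]; exact Int.floor_mono (by linarith)
    rcases (show ⌊x + s⌋ = ⌊x⌋ ∨ ⌊x + s⌋ = ⌊x⌋ + 1 by omega) with h | h
    · left
      rw [h] at hs
      rw [Metric.mem_closedBall, Real.dist_eq]
      convert hs using 2; ring
    · right
      rw [h] at hs; push_cast at hs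
      rw [Metric.mem_closedBall, Real.dist_eq]
      convert hs using 2; ring
  refine (measure_mono hsub).trans ((measure_union_le _ _).trans ?_)
  rw [Real.volume_closedBall, Real.volume_closedBall]
  rcases le_total 0 t with h | h
  · rw [← ENNReal.ofReal_add (by linarith) (by linarith)]
    exact ENNReal.ofReal_le_ofReal (by linarith)
  · rw [ENNReal.ofReal_of_nonpos (by linarith)]; simp

lemma volume_forall_halfDist_le {n : ℕ} (J : Finset (Fin n)) (y : Fin n → ℝ) (t : ℝ) :
    volume {a : Fin n → ℝ | a ∈ Icc (0 : Fin n → ℝ) 1 ∧ ∀ i ∈ J, halfDist ((y + a) i) ≤ t} ≤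
      ENNReal.ofReal (4 * t) ^ J.card := by
  have hsub : {a : Fin n → ℝ | a ∈ Icc (0 : Fin n → ℝ) 1 ∧ ∀ i ∈ J, halfDist ((y + a) i) ≤ t} ⊆
      univ.pi fun i => if i ∈ J then {s : ℝ | s ∈ Icc (0 : ℝ) 1 ∧ halfDist (y i + s) ≤ t}
        else Icc (0 : ℝ) 1 := by
    rintro a ⟨ha, hJ⟩ i -
    by_cases hi : i ∈ J
    · simp only [hi, if_true]
      exact ⟨⟨ha.1 i, ha.2 i⟩, hJ i hi⟩
    · simp only [hi, if_false]
      exact ⟨ha.1 i, ha.2 i⟩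
  refine (measure_mono hsub).trans ?_
  rw [volume_pi_pi]
  calc _ ≤ ∏ i, (if i ∈ J then ENNReal.ofReal (4 * t) else 1) := by
        refine Finset.prod_le_prod' fun i _ => ?_
        split_ifs
        · exact volume_halfDist_le _ _
        · simp
    _ = _ := by rw [Finset.prod_ite_mem]; simp

lemma volume_Icc_zero_one_pi (n : ℕ) : volume (Icc (0 : Fin n → ℝ) 1) = 1 := by
  rw [Real.volume_Icc_pi]; simp

lemma volume_dualDist_le {n : ℕ} (e : ℕ) (y : Fin n → ℝ) {t : ℝ} (ht : 0 ≤ t) :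
    volume {a : Fin n → ℝ | a ∈ Icc (0 : Fin n → ℝ) 1 ∧ dualDist e (y + a) ≤ t} ≤
      ENNReal.ofReal (2 ^ n * (4 * t) ^ (e + 1)) := by
  rcases lt_or_ge t (1 / 2) with h | h
  · have hsub : {a : Fin n → ℝ | a ∈ Icc (0 : Fin n → ℝ) 1 ∧ dualDist e (y + a) ≤ t} ⊆
        ⋃ J ∈ Finset.powersetCard (e + 1) (Finset.univ : Finset (Fin n)),
          {a : Fin n → ℝ | a ∈ Icc (0 : Fin n → ℝ) 1 ∧ ∀ i ∈ J, halfDist ((y + a) i) ≤ t} := by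
      rintro a ⟨ha, had⟩
      have hc := lt_card_of_dualDist_le h had
      obtain ⟨J, hJ, hJc⟩ := Finset.exists_subset_card_eq (Nat.succ_le_of_lt hc)
      simp only [mem_iUnion]
      refine ⟨J, Finset.mem_powersetCard.2 ⟨Finset.subset_univ _, hJc⟩, ha, fun i hi => ?_⟩
      exact (Finset.mem_filter.1 (hJ hi)).2
    refine (measure_mono hsub).trans ((measure_biUnion_finset_le _ _).trans ?_)
    calc _ ≤ ∑ J ∈ Finset.powersetCard (e + 1) (Finset.univ : Finset (Fin n)),
          ENNReal.ofReal (4 * t) ^ (e + 1) := by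
          refine Finset.sum_le_sum fun J hJ => ?_
          rw [← (Finset.mem_powersetCard.1 hJ).2]
          exact volume_forall_halfDist_le J y t
      _ ≤ 2 ^ n * ENNReal.ofReal (4 * t) ^ (e + 1) := by
          rw [Finset.sum_const, Finset.card_powersetCard, nsmul_eq_mul]
          gcongr
          rw [Finset.card_univ, Fintype.card_fin]
          exact_mod_cast Nat.choose_le_two_pow n (e + 1)
      _ = _ := by
          rw [ENNReal.ofReal_mul (p := 2 ^ n) (by positivity),
            ENNReal.ofReal_pow (p := 2) (by norm_num),
            ENNReal.ofReal_pow (p := 4 * t) (by positivity), ENNReal.ofReal_ofNat]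
  · refine (measure_mono fun a ha => ha.1).trans ?_
    rw [volume_Icc_zero_one_pi, ENNReal.one_le_ofReal]
    have h1 : (1 : ℝ) ≤ 2 ^ n := one_le_pow₀ (by norm_num)
    have h2 : (1 : ℝ) ≤ (4 * t) ^ (e + 1) := one_le_pow₀ (by linarith)
    nlinarith

lemma measurable_measure_dualDist_le {X : Type*} [MeasurableSpace X] {n : ℕ} (e : ℕ)
    (ν : Measure X) [IsFiniteMeasure ν] {g : X → Fin n → ℝ} (hg : Measurable g) (t : ℝ) :
    Measurable fun a : Fin n → ℝ => ν {x | dualDist e (g x + a) ≤ t} := by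
  have hPm : MeasurableSet {p : (Fin n → ℝ) × X | dualDist e (g p.2 + p.1) ≤ t} := by
    apply measurableSet_le _ measurable_const
    exact (lipschitzWith_dualDist e).continuous.measurable.comp
      ((hg.comp measurable_snd).add measurable_fst)
  exact measurable_measure_prodMk_left hPm

lemma lintegral_measure_dualDist_le {X : Type*} [MeasurableSpace X] {n : ℕ} (e : ℕ)
    (ν : Measure X) [IsFiniteMeasure ν] {g : X → Fin n → ℝ} (hg : Measurable g) {t : ℝ}
    (ht : 0 ≤ t) :
    ∫⁻ a in Icc (0 : Fin n → ℝ) 1, ν {x | dualDist e (g x + a) ≤ t} ≤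
      ENNReal.ofReal (2 ^ n * (4 * t) ^ (e + 1)) * ν univ := by
  set P : Set ((Fin n → ℝ) × X) := {p | dualDist e (g p.2 + p.1) ≤ t} with hP
  have hPm : MeasurableSet P := by
    apply measurableSet_le _ measurable_const
    exact (lipschitzWith_dualDist e).continuous.measurable.comp
      ((hg.comp measurable_snd).add measurable_fst)
  have h1 := Measure.prod_apply (μ := volume.restrict (Icc (0 : Fin n → ℝ) 1)) (ν := ν) hPm
  have h2 := Measure.prod_apply_symm (μ := volume.restrict (Icc (0 : Fin n → ℝ) 1)) (ν := ν) hPm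
  have h3 : ∫⁻ a in Icc (0 : Fin n → ℝ) 1, ν {x | dualDist e (g x + a) ≤ t} =
      ∫⁻ a in Icc (0 : Fin n → ℝ) 1, ν (Prod.mk a ⁻¹' P) := rfl
  rw [h3, ← h1, h2]
  calc _ ≤ ∫⁻ _, ENNReal.ofReal (2 ^ n * (4 * t) ^ (e + 1)) ∂ν := by
        refine lintegral_mono fun x => ?_
        have hm : MeasurableSet ((fun a => (a, x)) ⁻¹' P) := measurable_prodMk_right hPm
        rw [Measure.restrict_apply hm]
        refine le_trans (measure_mono ?_) (volume_dualDist_le e (g x) ht)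
        rintro a ⟨ha, ha'⟩
        exact ⟨ha', ha⟩
    _ = _ := by rw [lintegral_const]

/-- The translates for which the image of `S` meets the dual skeleton of codimension `e + 1` have
volume controlled by the `(e + 1)`-dimensional Hausdorff measure of `S`. -/
lemma volume_exists_dualDist_eq_zero_le {X : Type*} [MetricSpace X] [MeasurableSpace X]
    [BorelSpace X] {n : ℕ} (e : ℕ) (S : Set X) {g : X → Fin n → ℝ} {L : ℝ} (hL : 0 < L)
    (hg : ∀ x x', dist (g x) (g x') ≤ L * dist x x') :
    volume {a : Fin n → ℝ | a ∈ Icc (0 : Fin n → ℝ) 1 ∧ ∃ x ∈ S, dualDist e (g x + a) = 0} ≤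
      ENNReal.ofReal (2 ^ n * (4 * L) ^ (e + 1)) * μH[(e + 1 : ℕ)] S := by
  set c := ENNReal.ofReal (2 ^ n * (4 * L) ^ (e + 1)) with hc
  have hc0 : c ≠ 0 := by
    rw [hc, Ne, ENNReal.ofReal_eq_zero, not_le]; positivity
  have hct : c ≠ ⊤ := ENNReal.ofReal_ne_top
  rw [← ENNReal.inv_mul_le_iff hc0 hct, Measure.hausdorffMeasure_apply]
  refine le_trans ?_ (le_iSup₂ (1 : ℝ≥0∞) one_pos)
  refine le_iInf fun T => le_iInf fun hT => le_iInf fun hd => ?_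
  rw [ENNReal.inv_mul_le_iff hc0 hct, ← ENNReal.tsum_mul_left]
  have hsub : {a : Fin n → ℝ | a ∈ Icc (0 : Fin n → ℝ) 1 ∧ ∃ x ∈ S, dualDist e (g x + a) = 0} ⊆
      ⋃ l, {a : Fin n → ℝ | a ∈ Icc (0 : Fin n → ℝ) 1 ∧ ∃ x ∈ T l, dualDist e (g x + a) = 0} := by
    rintro a ⟨ha, x, hx, h0⟩
    obtain ⟨l, hl⟩ := mem_iUnion.1 (hT hx)
    exact mem_iUnion.2 ⟨l, ha, x, hl, h0⟩
  refine (measure_mono hsub).trans ((measure_iUnion_le _).trans (ENNReal.tsum_le_tsum fun l => ?_))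
  rcases (T l).eq_empty_or_nonempty with hemp | ⟨x0, hx0⟩
  · simp [hemp]
  · have hfin : Metric.ediam (T l) ≠ ⊤ := ((hd l).trans_lt ENNReal.one_lt_top).ne
    have hsub2 : {a : Fin n → ℝ | a ∈ Icc (0 : Fin n → ℝ) 1 ∧
        ∃ x ∈ T l, dualDist e (g x + a) = 0} ⊆ {a : Fin n → ℝ | a ∈ Icc (0 : Fin n → ℝ) 1 ∧
          dualDist e (g x0 + a) ≤ L * (Metric.ediam (T l)).toReal} := by
      rintro a ⟨ha, x, hx, h0⟩
      refine ⟨ha, ?_⟩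
      have h1 := dualDist_le_add_dist e (g x0 + a) (g x + a)
      have h2 : dist (g x0 + a) (g x + a) = dist (g x0) (g x) := by
        rw [dist_add_right]
      have h3 : dist x0 x ≤ (Metric.ediam (T l)).toReal := by
        rw [dist_edist]
        exact ENNReal.toReal_mono hfin (Metric.edist_le_ediam_of_mem hx0 hx)
      have h4 := hg x0 x
      have h5 := mul_le_mul_of_nonneg_left h3 hL.le
      linarith
    refine (measure_mono hsub2).trans ((volume_dualDist_le e _ (by positivity)).trans ?_)
    rw [ciSup_pos ⟨x0, hx0⟩, ENNReal.rpow_natCast, hc]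
    have e1 : (2 : ℝ) ^ n * (4 * (L * (Metric.ediam (T l)).toReal)) ^ (e + 1) =
        (2 ^ n * (4 * L) ^ (e + 1)) * (Metric.ediam (T l)).toReal ^ (e + 1) := by
      rw [← mul_assoc 4 L, mul_pow (4 * L)]; ring
    rw [e1, ENNReal.ofReal_mul (by positivity), ENNReal.ofReal_pow (by positivity),
      ENNReal.ofReal_toReal hfin]

/-! ### Grid coordinates -/

/-- Coordinates in which a translated grid of mesh `δ` becomes the unit grid. -/
noncomputable def toGrid {n : ℕ} (δ : ℝ) (a : Fin n → ℝ) (x : EuclideanSpace ℝ (Fin n)) :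
    Fin n → ℝ :=
  (fun i => x i / δ) + a

/-- The inverse of `toGrid`. -/
noncomputable def fromGrid {n : ℕ} (δ : ℝ) (a : Fin n → ℝ) (y : Fin n → ℝ) :
    EuclideanSpace ℝ (Fin n) :=
  WithLp.toLp 2 fun i => δ * (y i - a i)

section grid

variable {n : ℕ} {δ : ℝ} {a : Fin n → ℝ}

lemma fromGrid_toGrid (hδ : 0 < δ) (x : EuclideanSpace ℝ (Fin n)) :
    fromGrid δ a (toGrid δ a x) = x := by
  ext i
  simp only [fromGrid, toGrid, Pi.add_apply, add_sub_cancel_right]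
  field_simp

lemma dist_coord_div_le (hδ : 0 < δ) (x x' : EuclideanSpace ℝ (Fin n)) :
    dist (fun i => x i / δ : Fin n → ℝ) (fun i => x' i / δ) ≤ δ⁻¹ * dist x x' := by
  rw [dist_pi_le_iff (by positivity)]
  intro i
  have h : dist (x i) (x' i) ≤ dist x x' := by
    rw [dist_eq_norm, dist_eq_norm]
    simpa using PiLp.norm_apply_le (x - x') i
  rw [Real.dist_eq] at h ⊢
  rw [← sub_div, abs_div, abs_of_pos hδ, div_eq_inv_mul]
  gcongr

lemma dist_toGrid_le (hδ : 0 < δ) (x x' : EuclideanSpace ℝ (Fin n)) :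
    dist (toGrid δ a x) (toGrid δ a x') ≤ δ⁻¹ * dist x x' := by
  unfold toGrid
  rw [dist_add_right]
  exact dist_coord_div_le hδ x x'

lemma dist_fromGrid_le (hδ : 0 < δ) (y y' : Fin n → ℝ) :
    dist (fromGrid δ a y) (fromGrid δ a y') ≤ n * δ * dist y y' := by
  have h : ∀ i, dist (fromGrid δ a y i) (fromGrid δ a y' i) ≤ δ * dist y y' := by
    intro i
    have h1 := dist_le_pi_dist y y' i
    simp only [fromGrid]
    rw [Real.dist_eq] at h1 ⊢
    rw [← mul_sub, abs_mul, abs_of_pos hδ, sub_sub_sub_cancel_right]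
    gcongr
  have hn : (n : ℝ) ≤ (n : ℝ) ^ 2 := by exact_mod_cast Nat.le_self_pow two_ne_zero n
  rw [EuclideanSpace.dist_eq]
  apply Real.sqrt_le_iff.2 ⟨by positivity, ?_⟩
  calc _ ≤ ∑ _i : Fin n, (δ * dist y y') ^ 2 :=
        Finset.sum_le_sum fun i _ => pow_le_pow_left₀ dist_nonneg (h i) 2
    _ = n * (δ * dist y y') ^ 2 := by simp
    _ ≤ (n : ℝ) ^ 2 * (δ * dist y y') ^ 2 := by gcongr
    _ = _ := by ring

lemma measurable_coord_div (δ : ℝ) :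
    Measurable fun (x : EuclideanSpace ℝ (Fin n)) (i : Fin n) => x i / δ := by
  have : Continuous fun (x : EuclideanSpace ℝ (Fin n)) (i : Fin n) => x i / δ := by fun_prop
  exact this.measurable

/-! ### Hausdorff measure of the skeleton -/

/-- The closed face with free directions `I` and base point `k`, in the original coordinates, has
Hausdorff measure at most `(n δ) ^ I.card`. -/
lemma hausdorffMeasure_face_le (hδ : 0 < δ) (I : Finset (Fin n)) (k : Fin n → ℤ) :
    μH[(I.card : ℕ)] (fromGrid δ a '' {y | (∀ i ∈ I, y i ∈ Icc (k i : ℝ) (k i + 1)) ∧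
      ∀ i ∉ I, y i = k i}) ≤ ENNReal.ofReal ((n * δ) ^ I.card) := by
  set p : (I → ℝ) → (Fin n → ℝ) := fun z i => k i + if h : i ∈ I then z ⟨i, h⟩ else 0 with hp
  have hplip : ∀ z z', dist (p z) (p z') ≤ dist z z' := by
    intro z z'
    rw [dist_pi_le_iff dist_nonneg]
    intro i
    by_cases h : i ∈ I
    · simpa [hp, h] using dist_le_pi_dist z z' ⟨i, h⟩
    · simp [hp, h]
  have hlip : LipschitzWith (Real.toNNReal (n * δ)) (fromGrid δ a ∘ p) := by
    refine LipschitzWith.of_dist_le_mul fun z z' => ?_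
    rw [Real.coe_toNNReal _ (by positivity)]
    exact (dist_fromGrid_le hδ _ _).trans (by gcongr; exact hplip z z')
  have hsub : fromGrid δ a '' {y | (∀ i ∈ I, y i ∈ Icc (k i : ℝ) (k i + 1)) ∧
      ∀ i ∉ I, y i = k i} ⊆ (fromGrid δ a ∘ p) '' Icc (0 : I → ℝ) 1 := by
    rintro _ ⟨y, ⟨h1, h2⟩, rfl⟩
    refine ⟨fun i => y i - k i, ⟨fun i => ?_, fun i => ?_⟩, ?_⟩
    · have := (h1 i i.2).1
      simp only [Pi.zero_apply]; linarith
    · have := (h1 i i.2).2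
      simp only [Pi.one_apply]; linarith
    · simp only [Function.comp_apply]
      congr 1
      ext i
      by_cases h : i ∈ I
      · simp [hp, h]
      · simp [hp, h, h2 i h]
  refine (measure_mono hsub).trans ((hlip.hausdorffMeasure_image_le (by positivity) _).trans ?_)
  have hv : μH[(I.card : ℕ)] (Icc (0 : I → ℝ) 1) = 1 := by
    have := hausdorffMeasure_pi_real (ι := I)
    rw [Fintype.card_coe] at this
    rw [this, Real.volume_Icc_pi]; simp
  rw [hv, mul_one, ENNReal.rpow_natCast, ENNReal.ofReal_pow (by positivity)]
  rfl

lemma hausdorffMeasure_skeleton_le {e : ℕ} (he : e ≤ n) (hδ : 0 < δ) (y₀ : Fin n → ℝ) {Q : ℝ}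
    (hQ : 0 ≤ Q) :
    μH[(e : ℕ)] (fromGrid δ a '' (skeleton n e ∩ {y | dist y y₀ ≤ Q})) ≤
      ENNReal.ofReal (2 ^ n * (2 * Q + 3) ^ n * (n * δ) ^ e) := by
  set K : Finset (Fin n → ℤ) :=
    Fintype.piFinset fun i => Finset.Icc ⌊y₀ i - Q⌋ ⌊y₀ i + Q⌋ with hK
  have hcard : (K.card : ℝ) ≤ (2 * Q + 3) ^ n := by
    rw [hK, Fintype.card_piFinset]
    push_cast
    calc _ ≤ ∏ _i : Fin n, (2 * Q + 3) := by
          refine Finset.prod_le_prod (fun _ _ => by positivity) fun i _ => ?_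
          rw [Int.card_Icc]
          have h1 := Int.sub_one_lt_floor (y₀ i - Q)
          have h2 := Int.floor_le (y₀ i + Q)
          have h3 : ⌊y₀ i - Q⌋ ≤ ⌊y₀ i + Q⌋ := Int.floor_mono (by linarith)
          have h4 : (((⌊y₀ i + Q⌋ + 1 - ⌊y₀ i - Q⌋).toNat : ℤ) : ℝ) =
              ((⌊y₀ i + Q⌋ + 1 - ⌊y₀ i - Q⌋ : ℤ) : ℝ) := by
            rw [Int.toNat_of_nonneg (by omega)]
          push_cast at h4
          rw [h4]; linarith
      _ = _ := by simp
  have hsub : fromGrid δ a '' (skeleton n e ∩ {y | dist y y₀ ≤ Q}) ⊆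
      ⋃ q ∈ (Finset.powersetCard e (Finset.univ : Finset (Fin n))) ×ˢ K,
        fromGrid δ a '' {y | (∀ i ∈ q.1, y i ∈ Icc (q.2 i : ℝ) (q.2 i + 1)) ∧
          ∀ i ∉ q.1, y i = q.2 i} := by
    rintro _ ⟨y, ⟨⟨I, hI, hint⟩, hy⟩, rfl⟩
    obtain ⟨J, hIJ, -, hJ⟩ := Finset.exists_subsuperset_card_eq (Finset.subset_univ I) hI
      (by simpa using he)
    simp only [mem_iUnion]
    refine ⟨(J, fun i => ⌊y i⌋), ?_, y, ⟨fun i _ => ?_, fun i hi => ?_⟩, rfl⟩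
    · rw [Finset.mem_product]
      refine ⟨Finset.mem_powersetCard.2 ⟨Finset.subset_univ _, hJ⟩, ?_⟩
      rw [hK, Fintype.mem_piFinset]
      intro i
      have h1 := (dist_le_pi_dist y y₀ i).trans hy
      rw [Real.dist_eq, abs_le] at h1
      exact Finset.mem_Icc.2 ⟨Int.floor_mono (by linarith), Int.floor_mono (by linarith)⟩
    · exact ⟨Int.floor_le _, (Int.lt_floor_add_one _).le⟩
    · obtain ⟨z, hz⟩ := hint i fun h => hi (hIJ h)
      simp [← hz]
  refine (measure_mono hsub).trans ((measure_biUnion_finset_le _ _).trans ?_)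
  calc _ ≤ ∑ q ∈ (Finset.powersetCard e (Finset.univ : Finset (Fin n))) ×ˢ K,
        ENNReal.ofReal ((n * δ) ^ e) := by
        refine Finset.sum_le_sum fun q hq => ?_
        have hc := (Finset.mem_powersetCard.1 (Finset.mem_product.1 hq).1).2
        have := hausdorffMeasure_face_le (a := a) hδ q.1 q.2
        rw [hc] at this
        exact this
    _ = ENNReal.ofReal (((n.choose e * K.card : ℕ) : ℝ) * (n * δ) ^ e) := by
        rw [Finset.sum_const, Finset.card_product, Finset.card_powersetCard, nsmul_eq_mul,
          ENNReal.ofReal_mul (by positivity), ENNReal.ofReal_natCast, Finset.card_univ,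
          Fintype.card_fin]
    _ ≤ _ := by
        apply ENNReal.ofReal_le_ofReal
        push_cast
        have : (n.choose e : ℝ) ≤ 2 ^ n := by exact_mod_cast Nat.choose_le_two_pow n e
        gcongr

lemma hausdorffMeasure_skeleton_eq_zero {e : ℕ} (he : e ≤ n) (hδ : 0 < δ) :
    μH[(e + 1 : ℕ)] (fromGrid δ a '' skeleton n e) = 0 := by
  have hU : fromGrid δ a '' skeleton n e ⊆
      ⋃ N : ℕ, fromGrid δ a '' (skeleton n e ∩ {y | dist y 0 ≤ N}) := by
    rintro _ ⟨y, hy, rfl⟩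
    obtain ⟨N, hN⟩ := exists_nat_ge (dist y 0)
    exact mem_iUnion.2 ⟨N, y, ⟨hy, hN⟩, rfl⟩
  refine measure_mono_null hU (measure_iUnion_null fun N => ?_)
  have hlt : (e : ℝ) < ((e + 1 : ℕ) : ℝ) := by push_cast; linarith
  refine (Measure.hausdorffMeasure_zero_or_top hlt _).resolve_right ?_
  exact ((hausdorffMeasure_skeleton_le he hδ 0 (Nat.cast_nonneg N)).trans_lt
    ENNReal.ofReal_lt_top).ne

end grid

/-! ### The pushed competitor -/

/-- In grid coordinates, push the point `x` with a parameter `M x` depending on the point. -/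
noncomputable def gridPush {n : ℕ} (δ : ℝ) (a : Fin n → ℝ) (M : EuclideanSpace ℝ (Fin n) → ℝ)
    (x : EuclideanSpace ℝ (Fin n)) : EuclideanSpace ℝ (Fin n) :=
  fromGrid δ a fun i => push (M x) (toGrid δ a x i)

section gridPush

variable {n : ℕ} {δ : ℝ} {a : Fin n → ℝ} {M : EuclideanSpace ℝ (Fin n) → ℝ}

lemma dist_gridPush_self_le (hδ : 0 < δ) (x : EuclideanSpace ℝ (Fin n)) :
    dist (gridPush δ a M x) x ≤ n * δ := by
  have h := dist_fromGrid_le (a := a) hδ (fun i => push (M x) (toGrid δ a x i)) (toGrid δ a x)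
  rw [fromGrid_toGrid hδ] at h
  refine h.trans (mul_le_of_le_one_right (by positivity) ?_)
  rw [dist_pi_le_iff zero_le_one]
  intro i
  rw [Real.dist_eq]; exact abs_push_sub_self_le _ _

lemma gridPush_of_eq_half (hδ : 0 < δ) {x : EuclideanSpace ℝ (Fin n)} (h : M x = 1 / 2) :
    gridPush δ a M x = x := by
  unfold gridPush
  rw [h]
  simp only [push_half]
  exact fromGrid_toGrid hδ x

lemma lipschitzOnWith_gridPush (hδ : 0 < δ) (hM2 : ∀ x, M x ≤ 1 / 2)
    (hMlip : ∀ x x', |M x - M x'| ≤ 3 * δ⁻¹ * dist x x') {A : Set (EuclideanSpace ℝ (Fin n))}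
    {c : ℝ} (hc : 0 < c) (hcM : ∀ x ∈ A, c ≤ M x) :
    LipschitzOnWith (Real.toNNReal (2 * n / c)) (gridPush δ a M) A := by
  refine LipschitzOnWith.of_dist_le_mul fun x hx x' hx' => ?_
  rw [Real.coe_toNNReal _ (by positivity)]
  have h1 := dist_fromGrid_le (a := a) hδ (fun i => push (M x) (toGrid δ a x i))
    (fun i => push (M x') (toGrid δ a x' i))
  have h2 := dist_push_le (y := toGrid δ a x) (y' := toGrid δ a x') hc (hcM x hx) (hM2 x)
    (hcM x' hx') (hM2 x')
  have h3 := dist_toGrid_le (a := a) hδ x x'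
  have h4 := hMlip x x'
  refine h1.trans ?_
  calc _ ≤ n * δ * ((δ⁻¹ * dist x x' + 3 * δ⁻¹ * dist x x') / (2 * c)) := by
        gcongr; exact h2.trans (by gcongr)
    _ = 2 * n / c * dist x x' := by field_simp; ring

/-- The expansion of measure by a push, summed over the dyadic shells around the dual skeleton. -/
lemma measure_gridPush_image_le (hδ : 0 < δ) (hM2 : ∀ x, M x ≤ 1 / 2)
    (hMlip : ∀ x x', |M x - M x'| ≤ 3 * δ⁻¹ * dist x x') {A : Set (EuclideanSpace ℝ (Fin n))}
    {d : ℕ} (hA : ∀ x ∈ A, 0 < dualDist d (toGrid δ a x) ∧ dualDist d (toGrid δ a x) ≤ M x) :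
    μH[(d : ℕ)] (gridPush δ a M '' A) ≤ ∑' j : ℕ, ENNReal.ofReal ((4 * n * 2 ^ j) ^ d) *
      μH[(d : ℕ)] (A ∩ {x | dualDist d (toGrid δ a x) ≤ (1 / 2) ^ j}) := by
  have hsub : gridPush δ a M '' A ⊆ ⋃ j : ℕ, gridPush δ a M ''
      (A ∩ {x | (1 / 2) ^ (j + 1) < dualDist d (toGrid δ a x) ∧
        dualDist d (toGrid δ a x) ≤ (1 / 2) ^ j}) := by
    rintro _ ⟨x, hx, rfl⟩
    obtain ⟨j, hj1, hj2⟩ := exists_nat_pow_near_of_lt_one (hA x hx).1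
      ((dualDist_le_half d _).trans (by norm_num)) (show (0 : ℝ) < 1 / 2 by norm_num) (by norm_num)
    exact mem_iUnion.2 ⟨j, x, ⟨hx, hj1, hj2⟩, rfl⟩
  refine (measure_mono hsub).trans ((measure_iUnion_le _).trans (ENNReal.tsum_le_tsum fun j => ?_))
  have hlip : LipschitzOnWith (Real.toNNReal (2 * n / (1 / 2) ^ (j + 1))) (gridPush δ a M)
      (A ∩ {x | (1 / 2) ^ (j + 1) < dualDist d (toGrid δ a x) ∧
        dualDist d (toGrid δ a x) ≤ (1 / 2) ^ j}) :=
    lipschitzOnWith_gridPush hδ hM2 hMlip (by positivity)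
      fun x hx => hx.2.1.le.trans (hA x hx.1).2
  refine (hlip.hausdorffMeasure_image_le (by positivity)).trans ?_
  rw [ENNReal.rpow_natCast, ENNReal.ofReal_pow (by positivity)]
  have e : (2 * n / (1 / 2) ^ (j + 1) : ℝ) = 4 * n * 2 ^ j := by
    rw [one_div, inv_pow, div_inv_eq_mul, pow_succ]; ring
  rw [e]
  exact mul_le_mul' le_rfl (measure_mono fun x hx => ⟨hx.1, hx.2.2⟩)

end gridPush

/-! ### Choice of a good translate -/

/-- A bound for the average, over all grid translates, of the factor by which the push onto the
`d`-skeleton expands `d`-dimensional measure. -/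
noncomputable def pushConst (n d : ℕ) : ℝ := (4 * n) ^ d * 2 ^ n * 4 ^ (d + 1) * 2

lemma pushConst_nonneg (n d : ℕ) : 0 ≤ pushConst n d := by unfold pushConst; positivity

section translate

variable {n d : ℕ} {δ : ℝ}

/-- The average over `a` of the bound in `measure_gridPush_image_le`: the shell of index `j` has
volume of order `2 ^ (-j (d + 1))` in `a`, which beats the expansion `2 ^ (j d)`. -/
lemma lintegral_shells_le {A : Set (EuclideanSpace ℝ (Fin n))} (hA : MeasurableSet A)
    (hfin : μH[(d : ℕ)] A < ⊤) :
    ∫⁻ a in Icc (0 : Fin n → ℝ) 1, ∑' j : ℕ, ENNReal.ofReal ((4 * n * 2 ^ j) ^ d) *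
      μH[(d : ℕ)] (A ∩ {x | dualDist d (toGrid δ a x) ≤ (1 / 2) ^ j}) ≤
      ENNReal.ofReal (pushConst n d) * μH[(d : ℕ)] A := by
  set ν : Measure (EuclideanSpace ℝ (Fin n)) := μH[(d : ℕ)].restrict A with hν
  have : IsFiniteMeasure ν := ⟨by rw [hν, Measure.restrict_apply_univ]; exact hfin⟩
  have hνu : ν univ = μH[(d : ℕ)] A := by rw [hν, Measure.restrict_apply_univ]
  have hg : Measurable fun (x : EuclideanSpace ℝ (Fin n)) (i : Fin n) => x i / δ :=
    measurable_coord_div δ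
  have e : ∀ (a : Fin n → ℝ) (j : ℕ),
      μH[(d : ℕ)] (A ∩ {x | dualDist d (toGrid δ a x) ≤ (1 / 2) ^ j}) =
        ν {x | dualDist d ((fun i => x i / δ) + a) ≤ (1 / 2) ^ j} := by
    intro a j
    rw [hν, Measure.restrict_apply' hA, inter_comm]; rfl
  simp_rw [e]
  rw [lintegral_tsum fun j => ((measurable_measure_dualDist_le d ν hg _).const_mul _).aemeasurable]
  have hterm : ∀ j : ℕ, ∫⁻ a in Icc (0 : Fin n → ℝ) 1, ENNReal.ofReal ((4 * n * 2 ^ j) ^ d) *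
      ν {x | dualDist d ((fun i => x i / δ) + a) ≤ (1 / 2) ^ j} ≤
      ENNReal.ofReal ((4 * n) ^ d * 2 ^ n * 4 ^ (d + 1)) * 2⁻¹ ^ j * ν univ := by
    intro j
    rw [lintegral_const_mul _ (measurable_measure_dualDist_le d ν hg _)]
    refine (mul_le_mul' le_rfl (lintegral_measure_dualDist_le d ν hg (by positivity))).trans ?_
    rw [← mul_assoc, ← ENNReal.ofReal_mul (by positivity)]
    have e1 : ((4 * n * 2 ^ j) ^ d * (2 ^ n * (4 * (1 / 2) ^ j) ^ (d + 1)) : ℝ) =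
        ((4 * n) ^ d * 2 ^ n * 4 ^ (d + 1)) * (1 / 2) ^ j := by
      have e2 : ((2 : ℝ) ^ j) ^ d * ((1 / 2 : ℝ) ^ j) ^ d = 1 := by
        rw [← mul_pow, ← mul_pow]; norm_num
      rw [mul_pow (4 * (n : ℝ)) ((2 : ℝ) ^ j), mul_pow 4 ((1 / 2 : ℝ) ^ j),
        pow_succ ((1 / 2 : ℝ) ^ j) d]
      calc _ = ((4 * n) ^ d * 2 ^ n * 4 ^ (d + 1)) * (1 / 2) ^ j *
            (((2 : ℝ) ^ j) ^ d * ((1 / 2 : ℝ) ^ j) ^ d) := by ring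
        _ = _ := by rw [e2, mul_one]
    rw [e1, ENNReal.ofReal_mul (by positivity), ENNReal.ofReal_pow (by norm_num),
      show ENNReal.ofReal (1 / 2) = 2⁻¹ by
        rw [one_div, ENNReal.ofReal_inv_of_pos (by norm_num), ENNReal.ofReal_ofNat]]
  refine (ENNReal.tsum_le_tsum hterm).trans ?_
  rw [ENNReal.tsum_mul_right, ENNReal.tsum_mul_left, ENNReal.tsum_geometric, hνu,
    ENNReal.one_sub_inv_two, inv_inv, pushConst, ENNReal.ofReal_mul (q := 2) (by positivity),
    ENNReal.ofReal_ofNat]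

lemma exists_good_translate {A : Set (EuclideanSpace ℝ (Fin n))} (hA : MeasurableSet A)
    (hfin : μH[(d : ℕ)] A < ⊤) {N : Set (Fin n → ℝ)}
    (hN : volume {a | a ∈ Icc (0 : Fin n → ℝ) 1 ∧ a ∈ N} ≤ 2⁻¹) :
    ∃ a ∉ N, ∑' j : ℕ, ENNReal.ofReal ((4 * n * 2 ^ j) ^ d) *
      μH[(d : ℕ)] (A ∩ {x | dualDist d (toGrid δ a x) ≤ (1 / 2) ^ j}) ≤
      ENNReal.ofReal (2 * pushConst n d) * μH[(d : ℕ)] A := by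
  set N' := toMeasurable volume {a | a ∈ Icc (0 : Fin n → ℝ) 1 ∧ a ∈ N} with hN'
  have hN'v : volume N' ≤ 2⁻¹ := by rw [hN', measure_toMeasurable]; exact hN
  set G := Icc (0 : Fin n → ℝ) 1 \ N' with hG
  have hGv : 2⁻¹ ≤ volume G := by
    have h := le_measure_sdiff (μ := volume) (s₁ := Icc (0 : Fin n → ℝ) 1) (s₂ := N')
    rw [volume_Icc_zero_one_pi] at h
    refine le_trans ?_ h
    rw [← ENNReal.one_sub_inv_two]
    exact tsub_le_tsub_left hN'v 1
  have hG0 : volume G ≠ 0 := fun h => by simp [h] at hGv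
  have hGt : volume G ≠ ⊤ := by
    refine ne_top_of_le_ne_top ENNReal.one_ne_top ?_
    rw [← volume_Icc_zero_one_pi n]; exact measure_mono sdiff_subset
  set f : (Fin n → ℝ) → ℝ≥0∞ := fun a => ∑' j : ℕ, ENNReal.ofReal ((4 * n * 2 ^ j) ^ d) *
      μH[(d : ℕ)] (A ∩ {x | dualDist d (toGrid δ a x) ≤ (1 / 2) ^ j}) with hf
  have hfm : Measurable f := by
    have : IsFiniteMeasure ((μH[(d : ℕ)] : Measure (EuclideanSpace ℝ (Fin n))).restrict A) :=
      ⟨by rw [Measure.restrict_apply_univ]; exact hfin⟩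
    refine Measurable.tsum fun j => Measurable.const_mul ?_ _
    have := measurable_measure_dualDist_le (n := n) d
      ((μH[(d : ℕ)] : Measure (EuclideanSpace ℝ (Fin n))).restrict A)
      (measurable_coord_div δ) ((1 / 2 : ℝ) ^ j)
    convert this using 2 with a
    rw [Measure.restrict_apply' hA, inter_comm]; rfl
  obtain ⟨a, haG, ha⟩ := exists_le_setLAverage hG0 hGt hfm.aemeasurable
  refine ⟨a, fun haN => haG.2 (subset_toMeasurable _ _ ⟨haG.1, haN⟩), ha.trans ?_⟩
  rw [setLAverage_eq]
  refine ENNReal.div_le_of_le_mul ?_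
  have h1 : ∫⁻ a in G, f a ≤ ENNReal.ofReal (pushConst n d) * μH[(d : ℕ)] A :=
    (lintegral_mono_set sdiff_subset).trans (lintegral_shells_le hA hfin)
  refine h1.trans ?_
  calc _ = ENNReal.ofReal (2 * pushConst n d) * μH[(d : ℕ)] A * 2⁻¹ := by
        rw [ENNReal.ofReal_mul (by norm_num), ENNReal.ofReal_ofNat, mul_comm 2, mul_right_comm _ 2,
          mul_assoc _ 2, ENNReal.mul_inv_cancel (by norm_num) (by norm_num), mul_one]
    _ ≤ _ := by gcongr

end translate

/-! ### Using almost minimality -/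

/-- The ratio between the normalized and the unnormalized `d`-dimensional Hausdorff measures. -/
noncomputable def hausdorffRatio (d : ℕ) : ℝ≥0∞ :=
  ((Measure.addHaarScalarFactor (volume : Measure (EuclideanSpace ℝ (Fin d))) μH[d] : NNReal) :
    ℝ≥0∞)

lemma hausdorffRatio_ne_zero (d : ℕ) : hausdorffRatio d ≠ 0 := by
  unfold hausdorffRatio
  exact_mod_cast Measure.addHaarScalarFactor_volume_hausdorffMeasure_ne_zero d

lemma hausdorffRatio_ne_top (d : ℕ) : hausdorffRatio d ≠ ⊤ := ENNReal.coe_ne_top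

lemma euclideanHausdorffMeasure_eq {n : ℕ} (d : ℕ) (s : Set (EuclideanSpace ℝ (Fin n))) :
    μHE[d] s = hausdorffRatio d * μH[(d : ℕ)] s := by
  rw [Measure.euclideanHausdorffMeasure_def, Measure.smul_apply]; rfl

section minimal

variable {n d : ℕ} {h : ℝ → ℝ≥0∞} {U E : Set (EuclideanSpace ℝ (Fin n))}

lemma IsSlidingAlmostMinimal.measurableSet {Γ : Set (EuclideanSpace ℝ (Fin n))}
    (hE : IsSlidingAlmostMinimal d h Γ U E) (hU : IsOpen U) : MeasurableSet E := by
  obtain ⟨A, hA, rfl⟩ := hE.closed_in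
  exact hA.measurableSet.inter hU.measurableSet

lemma IsSlidingAlmostMinimal.isCompact_inter {Γ K : Set (EuclideanSpace ℝ (Fin n))}
    (hE : IsSlidingAlmostMinimal d h Γ U E) (hK : IsCompact K) (hKU : K ⊆ U) :
    IsCompact (E ∩ K) := by
  obtain ⟨A, hA, rfl⟩ := hE.closed_in
  rw [inter_assoc, inter_eq_right.2 hKU]
  exact hK.inter_left hA

lemma IsSlidingAlmostMinimal.hausdorffMeasure_lt_top {Γ K : Set (EuclideanSpace ℝ (Fin n))}
    (hE : IsSlidingAlmostMinimal d h Γ U E) (hK : IsCompact K) (hKU : K ⊆ U) :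
    μH[(d : ℕ)] (E ∩ K) < ⊤ := by
  have := hE.locally_finite K hK hKU
  rw [euclideanHausdorffMeasure_eq] at this
  by_contra! hc
  rw [top_le_iff.1 hc, ENNReal.mul_top (hausdorffRatio_ne_zero d)] at this
  exact lt_irrefl _ this

/-- A map that moves points by at most `ℓ`, is the identity off a ball of radius `s`, and is
Lipschitz on `E`, yields a competitor in any larger ball with radius at least `s + ℓ`, by linear
interpolation with the identity. -/
lemma IsSlidingAlmostMinimal.measure_le_of_map (hE : IsSlidingAlmostMinimal d h univ U E)
    (hU : IsOpen U) {x₀ : EuclideanSpace ℝ (Fin n)} {s ℓ ρ : ℝ} (hρ : 0 < ρ) (hℓ : 0 ≤ ℓ)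
    (hs : s + ℓ ≤ ρ) (hBU : Metric.closedBall x₀ ρ ⊆ U)
    {f : EuclideanSpace ℝ (Fin n) → EuclideanSpace ℝ (Fin n)} (hf : ∀ x, dist (f x) x ≤ ℓ)
    (hid : ∀ x, s ≤ dist x x₀ → f x = x) {K : NNReal} (hlip : LipschitzOnWith K f E) :
    μH[(d : ℕ)] (E ∩ Metric.closedBall x₀ s) ≤ μH[(d : ℕ)] (f '' (E ∩ Metric.closedBall x₀ s)) +
      h ρ / hausdorffRatio d * ENNReal.ofReal (ρ ^ d) := by
  set B := Metric.closedBall x₀ ρ with hB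
  set B' := Metric.closedBall x₀ s with hB'
  have hBB : B' ⊆ B := Metric.closedBall_subset_closedBall (by linarith)
  have hfB : ∀ x ∈ B, f x ∈ B := by
    intro x hx
    rcases le_total s (dist x x₀) with hxs | hxs
    · rw [hid x hxs]; exact hx
    · rw [hB, Metric.mem_closedBall]
      linarith [dist_triangle (f x) x x₀, hf x]
  have hcomp : IsSlidingCompetitor univ E B (f '' E) := by
    refine ⟨fun t x => (1 - t) • x + t • f x, ⟨?_, ?_, ?_, ?_, fun _ _ _ _ => mem_univ _, ?_⟩, ?_⟩
    · have hfc : ContinuousOn (fun p : EuclideanSpace ℝ (Fin n) × ℝ => f p.1)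
          (E ×ˢ Icc (0 : ℝ) 1) :=
        hlip.continuousOn.comp continuousOn_fst fun p hp => hp.1
      exact ((continuousOn_const.sub continuousOn_snd).smul continuousOn_fst).add
        (continuousOn_snd.smul hfc)
    · intro y _; simp
    · intro y hy t _
      have hy2 : s ≤ dist y x₀ := by
        have := hy.2
        rw [hB, Metric.mem_closedBall, not_le] at this
        linarith
      simp only [hid y hy2]
      rw [← add_smul, sub_add_cancel, one_smul]
    · rintro t ht _ ⟨y, hy, rfl⟩
      exact (convex_closedBall x₀ ρ) hy.2 (hfB y hy.2) (by linarith [ht.2]) ht.1 (by ring)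
    · refine ⟨K, ?_⟩
      simpa using hlip
    · simp
  have hmin := hE.almost_minimal x₀ ρ hρ hBU _ hcomp
  have hEm := hE.measurableSet hU
  have hm : MeasurableSet (E ∩ (B \ B')) :=
    hEm.inter
      (Metric.isClosed_closedBall.measurableSet.diff Metric.isClosed_closedBall.measurableSet)
  have hsplit : E ∩ B = (E ∩ B') ∪ (E ∩ (B \ B')) := by
    rw [← inter_union_distrib_left, union_sdiff_cancel hBB]
  have hdisj : Disjoint (E ∩ B') (E ∩ (B \ B')) :=
    disjoint_left.2 fun x hx hx' => hx'.2.2 hx.2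
  have himg : f '' E ∩ B ⊆ f '' (E ∩ B') ∪ (E ∩ (B \ B')) := by
    rintro _ ⟨⟨x, hx, rfl⟩, hfx⟩
    by_cases hxB : x ∈ B'
    · exact Or.inl ⟨x, ⟨hx, hxB⟩, rfl⟩
    · have h1 : f x = x := by
        rw [hB', Metric.mem_closedBall, not_le] at hxB
        exact hid x hxB.le
      rw [h1] at hfx ⊢
      exact Or.inr ⟨hx, hfx, hxB⟩
  rw [euclideanHausdorffMeasure_eq, euclideanHausdorffMeasure_eq] at hmin
  have h0 := hausdorffRatio_ne_zero d
  have ht := hausdorffRatio_ne_top d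
  have hmin2 : μH[(d : ℕ)] (E ∩ B) ≤ μH[(d : ℕ)] (f '' E ∩ B) +
      h ρ / hausdorffRatio d * ENNReal.ofReal (ρ ^ d) := by
    rw [← ENNReal.mul_le_mul_iff_right h0 ht]
    refine hmin.trans_eq ?_
    rw [mul_add, ← mul_assoc (hausdorffRatio d) (h ρ / hausdorffRatio d),
      ENNReal.mul_div_cancel h0 ht]
  rw [hsplit, measure_union hdisj hm] at hmin2
  have hfin : μH[(d : ℕ)] (E ∩ (B \ B')) ≠ ⊤ :=
    ((measure_mono (inter_subset_inter_right _ sdiff_subset)).trans_lt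
      (hE.hausdorffMeasure_lt_top (isCompact_closedBall x₀ ρ) hBU)).ne
  have h3 := (measure_mono himg).trans (measure_union_le (μ := μH[(d : ℕ)]) _ _)
  rw [← ENNReal.add_le_add_iff_right hfin]
  refine hmin2.trans ((add_le_add_left h3 _).trans_eq ?_)
  ring

end minimal

/-! ### One step of the comparison -/

/-- A cutoff equal to `0` on the closed ball of radius `s` and to `1/2` off the ball of
radius `s + δ`. -/
noncomputable def cutoff {n : ℕ} (δ : ℝ) (x₀ : EuclideanSpace ℝ (Fin n)) (s : ℝ)
    (x : EuclideanSpace ℝ (Fin n)) : ℝ :=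
  min (1 / 2) (max 0 ((dist x x₀ - s) / δ))

/-- The push parameter that follows `μ` (in grid coordinates) inside the ball of radius `s`, and
increases to `1/2`, for which the push is the identity, outside the ball of radius `s + δ`. -/
noncomputable def cutParam {n : ℕ} (δ : ℝ) (a : Fin n → ℝ) (μ : (Fin n → ℝ) → ℝ)
    (x₀ : EuclideanSpace ℝ (Fin n)) (s : ℝ) (x : EuclideanSpace ℝ (Fin n)) : ℝ :=
  max (μ (toGrid δ a x)) (cutoff δ x₀ s x)

section cutParam

variable {n : ℕ} {δ s : ℝ} {a : Fin n → ℝ} {μ : (Fin n → ℝ) → ℝ} {x₀ x : EuclideanSpace ℝ (Fin n)}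

lemma cutoff_le_half : cutoff δ x₀ s x ≤ 1 / 2 := min_le_left _ _

lemma cutoff_eq_zero (hδ : 0 < δ) (h : dist x x₀ ≤ s) : cutoff δ x₀ s x = 0 := by
  unfold cutoff
  rw [max_eq_left (div_nonpos_of_nonpos_of_nonneg (by linarith) hδ.le)]
  norm_num

lemma cutoff_eq_half (hδ : 0 < δ) (h : s + δ ≤ dist x x₀) : cutoff δ x₀ s x = 1 / 2 := by
  have h1 : (1 : ℝ) ≤ (dist x x₀ - s) / δ := by rw [le_div_iff₀ hδ]; linarith
  unfold cutoff
  rw [max_eq_right (by linarith), min_eq_left (by linarith)]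

lemma abs_cutoff_sub_le (hδ : 0 < δ) (x x' : EuclideanSpace ℝ (Fin n)) :
    |cutoff δ x₀ s x - cutoff δ x₀ s x'| ≤ δ⁻¹ * dist x x' := by
  unfold cutoff
  set A := (dist x x₀ - s) / δ
  set A' := (dist x' x₀ - s) / δ
  have h1 : |min (1 / 2) (max 0 A) - min (1 / 2) (max 0 A')| ≤ |max 0 A - max 0 A'| := by
    simpa using abs_min_sub_min_le_max (1 / 2 : ℝ) (max 0 A) (1 / 2) (max 0 A')
  have h2 : |max 0 A - max 0 A'| ≤ |A - A'| := by
    simpa using abs_max_sub_max_le_max (0 : ℝ) A 0 A'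
  refine h1.trans (h2.trans ?_)
  have e : A - A' = δ⁻¹ * (dist x x₀ - dist x' x₀) := by
    simp only [A, A']; field_simp; ring
  rw [e, abs_mul, abs_of_pos (inv_pos.2 hδ)]
  have := abs_dist_sub_le x x' x₀
  gcongr

lemma cutParam_le_half (hμ : ∀ y, μ y ≤ 1 / 2) (x : EuclideanSpace ℝ (Fin n)) :
    cutParam δ a μ x₀ s x ≤ 1 / 2 :=
  max_le (hμ _) cutoff_le_half

lemma cutParam_eq_half (hδ : 0 < δ) (hμ : ∀ y, μ y ≤ 1 / 2) (h : s + δ ≤ dist x x₀) :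
    cutParam δ a μ x₀ s x = 1 / 2 := by
  unfold cutParam
  rw [cutoff_eq_half hδ h, max_eq_right (hμ _)]

lemma cutParam_eq (hδ : 0 < δ) (hμ0 : ∀ y, 0 ≤ μ y) (h : dist x x₀ ≤ s) :
    cutParam δ a μ x₀ s x = μ (toGrid δ a x) := by
  unfold cutParam
  rw [cutoff_eq_zero hδ h, max_eq_left (hμ0 _)]

lemma abs_cutParam_sub_le (hδ : 0 < δ) (hμ : ∀ y z, μ y ≤ μ z + 3 * dist y z)
    (x x' : EuclideanSpace ℝ (Fin n)) :
    |cutParam δ a μ x₀ s x - cutParam δ a μ x₀ s x'| ≤ 3 * δ⁻¹ * dist x x' := by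
  unfold cutParam
  refine (abs_max_sub_max_le_max _ _ _ _).trans (max_le ?_ ?_)
  · have h1 := hμ (toGrid δ a x) (toGrid δ a x')
    have h2 := hμ (toGrid δ a x') (toGrid δ a x)
    have h3 := dist_toGrid_le (a := a) hδ x x'
    rw [dist_comm (toGrid δ a x')] at h2
    rw [abs_le]
    constructor <;> linarith
  · have h1 := abs_cutoff_sub_le (x₀ := x₀) (s := s) hδ x x'
    have h2 : 0 ≤ δ⁻¹ * dist x x' := by positivity
    linarith

end cutParam

section step

variable {n d : ℕ} {h : ℝ → ℝ≥0∞} {U E : Set (EuclideanSpace ℝ (Fin n))}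

/-- Almost minimality applied to the push with parameter `cutParam δ a μ x₀ s`. -/
lemma IsSlidingAlmostMinimal.measure_le_gridPush (hE : IsSlidingAlmostMinimal d h univ U E)
    (hU : IsOpen U) {x₀ : EuclideanSpace ℝ (Fin n)} {s δ ρ : ℝ} (hδ : 0 < δ) (hρ : 0 < ρ)
    (hs : s + δ + n * δ ≤ ρ) (hBU : Metric.closedBall x₀ ρ ⊆ U) {a : Fin n → ℝ}
    {μ : (Fin n → ℝ) → ℝ} (hμ : ∀ y, μ y ≤ 1 / 2) (hμl : ∀ y z, μ y ≤ μ z + 3 * dist y z)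
    (hpos : ∀ x ∈ E ∩ Metric.closedBall x₀ ρ, 0 < μ (toGrid δ a x)) :
    μH[(d : ℕ)] (E ∩ Metric.closedBall x₀ (s + δ)) ≤
      μH[(d : ℕ)] (gridPush δ a (cutParam δ a μ x₀ s) '' (E ∩ Metric.closedBall x₀ (s + δ))) +
      h ρ / hausdorffRatio d * ENNReal.ofReal (ρ ^ d) := by
  set M := cutParam δ a μ x₀ s with hM
  have hMlip : ∀ x x', |M x - M x'| ≤ 3 * δ⁻¹ * dist x x' := abs_cutParam_sub_le hδ hμl
  have hMc : Continuous M := by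
    have : LipschitzWith (Real.toNNReal (3 * δ⁻¹)) M := by
      refine LipschitzWith.of_dist_le_mul fun x x' => ?_
      rw [Real.coe_toNNReal _ (by positivity), Real.dist_eq]
      exact hMlip x x'
    exact this.continuous
  have hMhalf : ∀ x, s + δ ≤ dist x x₀ → M x = 1 / 2 := fun x hx => cutParam_eq_half hδ hμ hx
  -- by compactness the parameter is bounded below on `E`
  obtain ⟨c, hc, hcM⟩ : ∃ c : ℝ, 0 < c ∧ ∀ x ∈ E, c ≤ M x := by
    have hK : IsCompact (E ∩ Metric.closedBall x₀ ρ) :=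
      hE.isCompact_inter (isCompact_closedBall x₀ ρ) hBU
    have hMpos : ∀ x ∈ E ∩ Metric.closedBall x₀ ρ, 0 < M x := fun x hx =>
      (hpos x hx).trans_le (le_max_left _ _)
    obtain ⟨c, hc, hcK⟩ := hK.exists_forall_le' hMc.continuousOn hMpos
    refine ⟨min c (1 / 2), lt_min hc (by norm_num), fun x hx => ?_⟩
    by_cases hxB : x ∈ Metric.closedBall x₀ ρ
    · exact (min_le_left _ _).trans (hcK x ⟨hx, hxB⟩)
    · rw [Metric.mem_closedBall, not_le] at hxB
      have : 0 ≤ n * δ := by positivity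
      rw [hMhalf x (by linarith)]
      exact min_le_right _ _
  exact hE.measure_le_of_map hU hρ (by positivity) hs hBU (fun x => dist_gridPush_self_le hδ x)
    (fun x hx => gridPush_of_eq_half hδ (hMhalf x hx))
    (lipschitzOnWith_gridPush hδ (cutParam_le_half hμ) hMlip hc hcM)

lemma closedBall_subset_of_step {x₀ : EuclideanSpace ℝ (Fin n)} {s δ : ℝ} (hδ : 0 < δ) :
    Metric.closedBall x₀ (s + n * δ + δ) ⊆ Metric.closedBall x₀ (s + (2 * n + 1) * δ) := by
  apply Metric.closedBall_subset_closedBall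
  have : 0 ≤ n * δ := by positivity
  linarith

/-- The push onto the `d`-skeleton, cut off in an annulus of width proportional to the mesh. -/
lemma IsSlidingAlmostMinimal.measure_le_skeleton_add (hE : IsSlidingAlmostMinimal d h univ U E)
    (hU : IsOpen U) (hd : d ≤ n) {x₀ : EuclideanSpace ℝ (Fin n)} {s δ ρ : ℝ} (hδ : 0 < δ)
    (hs0 : 0 ≤ s) (hs : s + (2 * n + 1) * δ ≤ ρ) (hBU : Metric.closedBall x₀ ρ ⊆ U) :
    μH[(d : ℕ)] (E ∩ Metric.closedBall x₀ s) ≤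
      ENNReal.ofReal (2 ^ n * (2 * (s / δ + 1) + 3) ^ n * (n * δ) ^ d) +
      ENNReal.ofReal (2 * pushConst n d) * μH[(d : ℕ)]
        (E ∩ (Metric.closedBall x₀ (s + (2 * n + 1) * δ) \ Metric.closedBall x₀ s)) +
      h ρ / hausdorffRatio d * ENNReal.ofReal (ρ ^ d) := by
  have hnδ : 0 ≤ n * δ := by positivity
  have hρ : 0 < ρ := by linarith
  have hEm := hE.measurableSet hU
  have hfin := hE.hausdorffMeasure_lt_top (isCompact_closedBall x₀ ρ) hBU
  set A := E ∩ (Metric.closedBall x₀ (s + n * δ + δ) \ Metric.closedBall x₀ s) with hA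
  have hAm : MeasurableSet A :=
    hEm.inter
      (Metric.isClosed_closedBall.measurableSet.diff Metric.isClosed_closedBall.measurableSet)
  have hAρ : A ⊆ E ∩ Metric.closedBall x₀ ρ := fun x hx =>
    ⟨hx.1, Metric.closedBall_subset_closedBall hs (closedBall_subset_of_step hδ hx.2.1)⟩
  -- for almost every translate, `E` does not meet the dual skeleton of codimension `d + 1`
  have hN : volume {a : Fin n → ℝ | a ∈ Icc (0 : Fin n → ℝ) 1 ∧
      a ∈ {a | ∃ x ∈ E ∩ Metric.closedBall x₀ ρ, dualDist d (toGrid δ a x) = 0}} ≤ 2⁻¹ := by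
    have h1 := volume_exists_dualDist_eq_zero_le d (E ∩ Metric.closedBall x₀ ρ) (inv_pos.2 hδ)
      (dist_coord_div_le hδ)
    have h2 : μH[(d + 1 : ℕ)] (E ∩ Metric.closedBall x₀ ρ) = 0 := by
      have hlt : (d : ℝ) < ((d + 1 : ℕ) : ℝ) := by push_cast; linarith
      exact (Measure.hausdorffMeasure_zero_or_top hlt _).resolve_right hfin.ne
    rw [h2, mul_zero] at h1
    exact h1.trans bot_le
  obtain ⟨a, haN, ha⟩ := exists_good_translate hAm ((measure_mono hAρ).trans_lt hfin) hN
  have hpos : ∀ x ∈ E ∩ Metric.closedBall x₀ ρ, 0 < dualDist d (toGrid δ a x) := fun x hx =>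
    lt_of_le_of_ne (dualDist_nonneg _ _) fun h0 => haN ⟨x, hx, h0.symm⟩
  have hlip3 : ∀ y z : Fin n → ℝ, dualDist d y ≤ dualDist d z + 3 * dist y z := fun y z => by
    linarith [dualDist_le_add_dist d y z, dist_nonneg (x := y) (y := z)]
  have hmain := hE.measure_le_gridPush hU (x₀ := x₀) (s := s + n * δ) hδ hρ (by linarith) hBU
    (a := a) (μ := dualDist d) (dualDist_le_half d) hlip3 hpos
  set M := cutParam δ a (dualDist d) x₀ (s + n * δ) with hM
  have hsub : gridPush δ a M '' (E ∩ Metric.closedBall x₀ (s + n * δ + δ)) ⊆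
      fromGrid δ a '' (skeleton n d ∩ {y | dist y (toGrid δ a x₀) ≤ s / δ + 1}) ∪
        gridPush δ a M '' A := by
    rintro _ ⟨x, hx, rfl⟩
    by_cases hxs : x ∈ Metric.closedBall x₀ s
    · left
      have hxs' := Metric.mem_closedBall.1 hxs
      have hMx : M x = dualDist d (toGrid δ a x) :=
        cutParam_eq hδ (dualDist_nonneg d) (by linarith)
      have hxρ : x ∈ E ∩ Metric.closedBall x₀ ρ :=
        ⟨hx.1, Metric.closedBall_subset_closedBall hs (closedBall_subset_of_step hδ hx.2)⟩
      refine ⟨_, ⟨push_mem_skeleton (m := M x) ?_ hMx.le, ?_⟩, rfl⟩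
      · rw [hMx]; exact hpos x hxρ
      · have h1 := dist_toGrid_le (a := a) hδ x x₀
        have h2 : dist (fun i => push (M x) (toGrid δ a x i)) (toGrid δ a x) ≤ 1 := by
          rw [dist_pi_le_iff zero_le_one]
          intro i
          rw [Real.dist_eq]; exact abs_push_sub_self_le _ _
        have h3 := dist_triangle (fun i => push (M x) (toGrid δ a x i)) (toGrid δ a x)
          (toGrid δ a x₀)
        have h4 : δ⁻¹ * dist x x₀ ≤ s / δ := by
          rw [div_eq_inv_mul]; gcongr
        rw [mem_ofPred_eq]; linarith
    · exact Or.inr ⟨x, ⟨hx.1, hx.2, hxs⟩, rfl⟩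
  have hlayer : μH[(d : ℕ)] (gridPush δ a M '' A) ≤ ENNReal.ofReal (2 * pushConst n d) *
      μH[(d : ℕ)] A :=
    (measure_gridPush_image_le hδ (cutParam_le_half (dualDist_le_half d))
      (abs_cutParam_sub_le hδ hlip3)
      fun x hx => ⟨hpos x (hAρ hx), le_max_left _ _⟩).trans ha
  calc μH[(d : ℕ)] (E ∩ Metric.closedBall x₀ s)
      ≤ μH[(d : ℕ)] (E ∩ Metric.closedBall x₀ (s + n * δ + δ)) :=
        measure_mono (inter_subset_inter_right _
          (Metric.closedBall_subset_closedBall (by linarith)))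
    _ ≤ _ := hmain
    _ ≤ _ := by
        refine add_le_add_left ?_ _
        refine (measure_mono hsub).trans ((measure_union_le _ _).trans (add_le_add ?_ ?_))
        · exact hausdorffMeasure_skeleton_le hd hδ _ (by positivity)
        · refine hlayer.trans (mul_le_mul' le_rfl (measure_mono ?_))
          exact inter_subset_inter_right _ (sdiff_subset_sdiff_left (closedBall_subset_of_step hδ))

/-- When `E` has small measure at the scale of the mesh, it can be pushed onto the `d`-skeleton,
which has zero `(d + 1)`-dimensional measure; near the boundary the push stops at the
`(d + 1)`-skeleton, so that the expansion factor remains integrable. -/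
lemma IsSlidingAlmostMinimal.measure_le_annulus_add
    (hE : IsSlidingAlmostMinimal (d + 1) h univ U E)
    (hU : IsOpen U) (hd : d + 1 ≤ n) {x₀ : EuclideanSpace ℝ (Fin n)} {s δ ρ : ℝ} (hδ : 0 < δ)
    (hs0 : 0 ≤ s) (hs : s + (2 * n + 1) * δ ≤ ρ) (hBU : Metric.closedBall x₀ ρ ⊆ U)
    (hsmall : ENNReal.ofReal (2 ^ n * (4 * δ⁻¹) ^ (d + 1)) *
      μH[(d + 1 : ℕ)] (E ∩ Metric.closedBall x₀ ρ) ≤ 2⁻¹) :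
    μH[(d + 1 : ℕ)] (E ∩ Metric.closedBall x₀ s) ≤
      ENNReal.ofReal (2 * pushConst n (d + 1)) * μH[(d + 1 : ℕ)]
        (E ∩ (Metric.closedBall x₀ (s + (2 * n + 1) * δ) \ Metric.closedBall x₀ s)) +
      h ρ / hausdorffRatio (d + 1) * ENNReal.ofReal (ρ ^ (d + 1)) := by
  have hnδ : 0 ≤ n * δ := by positivity
  have hρ : 0 < ρ := by linarith
  have hEm := hE.measurableSet hU
  have hfin := hE.hausdorffMeasure_lt_top (isCompact_closedBall x₀ ρ) hBU
  set A := E ∩ (Metric.closedBall x₀ (s + n * δ + δ) \ Metric.closedBall x₀ s) with hA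
  have hAm : MeasurableSet A :=
    hEm.inter
      (Metric.isClosed_closedBall.measurableSet.diff Metric.isClosed_closedBall.measurableSet)
  have hAρ : A ⊆ E ∩ Metric.closedBall x₀ ρ := fun x hx =>
    ⟨hx.1, Metric.closedBall_subset_closedBall hs (closedBall_subset_of_step hδ hx.2.1)⟩
  have hN : volume {a : Fin n → ℝ | a ∈ Icc (0 : Fin n → ℝ) 1 ∧
      a ∈ {a | ∃ x ∈ E ∩ Metric.closedBall x₀ ρ, dualDist d (toGrid δ a x) = 0}} ≤ 2⁻¹ :=
    (volume_exists_dualDist_eq_zero_le d (E ∩ Metric.closedBall x₀ ρ) (inv_pos.2 hδ)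
      (dist_coord_div_le hδ)).trans hsmall
  obtain ⟨a, haN, ha⟩ := exists_good_translate hAm ((measure_mono hAρ).trans_lt hfin) hN
  have hpos : ∀ x ∈ E ∩ Metric.closedBall x₀ ρ, 0 < dualDist d (toGrid δ a x) := fun x hx =>
    lt_of_le_of_ne (dualDist_nonneg _ _) fun h0 => haN ⟨x, hx, h0.symm⟩
  have hlip3 : ∀ y z : Fin n → ℝ, dualDist (d + 1) y ≤ dualDist (d + 1) z + 3 * dist y z :=
    fun y z => by
      linarith [dualDist_le_add_dist (d + 1) y z, dist_nonneg (x := y) (y := z)]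
  set D := toGrid δ a '' Metric.closedBall x₀ s with hD
  have hmain := hE.measure_le_gridPush hU (x₀ := x₀) (s := s + n * δ) hδ hρ (by linarith) hBU
    (a := a) (μ := pushParam d D) (pushParam_le_half d D) (pushParam_le_add d D)
    fun x hx => (hpos x hx).trans_le (dualDist_le_pushParam d D _)
  set M := cutParam δ a (pushParam d D) x₀ (s + n * δ) with hM
  set M' := cutParam δ a (dualDist (d + 1)) x₀ (s + n * δ) with hM'
  have hsub : gridPush δ a M '' (E ∩ Metric.closedBall x₀ (s + n * δ + δ)) ⊆
      fromGrid δ a '' skeleton n d ∪ gridPush δ a M' '' A := by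
    rintro _ ⟨x, hx, rfl⟩
    have hxρ : x ∈ E ∩ Metric.closedBall x₀ ρ :=
      ⟨hx.1, Metric.closedBall_subset_closedBall hs (closedBall_subset_of_step hδ hx.2)⟩
    -- points near the inner ball where the stronger push is used, without cutoff
    have key : dist x x₀ ≤ s + n * δ → pushParam d D (toGrid δ a x) = dualDist d (toGrid δ a x) →
        gridPush δ a M x ∈ fromGrid δ a '' skeleton n d := by
      intro h1 h2
      have hMx : M x = dualDist d (toGrid δ a x) := by
        rw [← h2]
        exact cutParam_eq hδ (fun y => (dualDist_nonneg d y).trans (dualDist_le_pushParam d D y)) h1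
      refine ⟨_, push_mem_skeleton (m := M x) ?_ hMx.le, rfl⟩
      rw [hMx]; exact hpos x hxρ
    rcases pushParam_eq_or d D (toGrid δ a x) with ⟨h1, z, ⟨w, hw, rfl⟩, hz⟩ | h1
    · refine Or.inl (key ?_ h1)
      have h2 := dist_fromGrid_le (a := a) hδ (toGrid δ a x) (toGrid δ a w)
      rw [fromGrid_toGrid hδ, fromGrid_toGrid hδ] at h2
      have h3 : n * δ * dist (toGrid δ a x) (toGrid δ a w) ≤ n * δ := by
        refine mul_le_of_le_one_right hnδ ?_
        rw [dist_comm]; exact hz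
      have h4 := dist_triangle x w x₀
      have h5 := Metric.mem_closedBall.1 hw
      linarith
    · by_cases hxs : x ∈ Metric.closedBall x₀ s
      · refine Or.inl (key ?_ (pushParam_of_mem ⟨x, hxs, rfl⟩))
        have := Metric.mem_closedBall.1 hxs
        linarith
      · refine Or.inr ⟨x, ⟨hx.1, hx.2, hxs⟩, ?_⟩
        have hMM : M x = M' x := by
          rw [hM, hM']; unfold cutParam; rw [h1]
        unfold gridPush; rw [hMM]
  have hlayer : μH[(d + 1 : ℕ)] (gridPush δ a M' '' A) ≤
      ENNReal.ofReal (2 * pushConst n (d + 1)) * μH[(d + 1 : ℕ)] A :=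
    (measure_gridPush_image_le hδ (cutParam_le_half (dualDist_le_half (d + 1)))
      (abs_cutParam_sub_le hδ hlip3)
      fun x hx => ⟨(hpos x (hAρ hx)).trans_le (dualDist_mono (Nat.le_succ d) _),
        le_max_left _ _⟩).trans ha
  calc μH[(d + 1 : ℕ)] (E ∩ Metric.closedBall x₀ s)
      ≤ μH[(d + 1 : ℕ)] (E ∩ Metric.closedBall x₀ (s + n * δ + δ)) :=
        measure_mono (inter_subset_inter_right _
          (Metric.closedBall_subset_closedBall (by linarith)))
    _ ≤ _ := hmain
    _ ≤ _ := by
        refine add_le_add_left ?_ _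
        refine (measure_mono hsub).trans ((measure_union_le _ _).trans ?_)
        rw [hausdorffMeasure_skeleton_eq_zero (by omega) hδ, zero_add]
        refine hlayer.trans (mul_le_mul' le_rfl (measure_mono ?_))
        exact inter_subset_inter_right _ (sdiff_subset_sdiff_left (closedBall_subset_of_step hδ))

end step

/-! ### Upper bound by hole filling -/

/-- An iteration lemma: if `f s` is controlled by a fraction of `f t` and a negative power of
`t - s`, then summing over radii `ρ (1 - τ ^ k / 2)`, with `τ` close to `1` so that `θ < τ ^ p`,
bounds `f (ρ / 2)`. -/
lemma exists_iteration_bound {θ : ℝ} (hθ0 : 0 ≤ θ) (hθ1 : θ < 1) (p : ℕ) :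
    ∃ C : ℝ, 0 ≤ C ∧ ∀ (f : ℝ → ℝ) (ρ b : ℝ), 0 < ρ → 0 ≤ b → (∀ s ≤ ρ, f s ≤ f ρ) →
      (∀ s t, ρ / 2 ≤ s → s < t → t ≤ ρ → f s ≤ θ * f t + b * (ρ / (t - s)) ^ p) →
      f (ρ / 2) ≤ C * b := by
  obtain ⟨τ, hτ, hτ0, hτ1⟩ : ∃ τ : ℝ, θ < τ ^ p ∧ 0 < τ ∧ τ < 1 := by
    have ht : Tendsto (fun τ : ℝ => τ ^ p) (𝓝[<] 1) (𝓝 1) := by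
      have : Tendsto (fun τ : ℝ => τ ^ p) (𝓝 1) (𝓝 (1 ^ p)) := (continuous_pow p).tendsto 1
      rw [one_pow] at this
      exact this.mono_left nhdsWithin_le_nhds
    have h1 := ht.eventually (lt_mem_nhds hθ1)
    have h2 : ∀ᶠ τ : ℝ in 𝓝[<] 1, τ ∈ Ioo (0 : ℝ) 1 := Ioo_mem_nhdsLT one_pos
    obtain ⟨τ, a, b, c⟩ := (h1.and h2).exists
    exact ⟨τ, a, b, c⟩
  have hτp : 0 < τ ^ p := pow_pos hτ0 p
  set q := θ / τ ^ p with hq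
  have hq0 : 0 ≤ q := by positivity
  have hq1 : q < 1 := (div_lt_one hτp).2 hτ
  have h1τ : 0 < 1 - τ := by linarith
  have h1q : 0 < 1 - q := by linarith
  refine ⟨(2 / (1 - τ)) ^ p * (1 - q)⁻¹, by positivity, fun f ρ b hρ hb hmono hf => ?_⟩
  set s : ℕ → ℝ := fun k => ρ * (1 - τ ^ k / 2) with hs
  have hstep : ∀ k, s (k + 1) - s k = ρ * τ ^ k * (1 - τ) / 2 := fun k => by
    simp only [hs, pow_succ]; ring
  have hs_le : ∀ k, s k ≤ ρ := fun k => by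
    have : 0 < τ ^ k := pow_pos hτ0 k
    simp only [hs]; nlinarith
  have hs_ge : ∀ k, ρ / 2 ≤ s k := fun k => by
    have : τ ^ k ≤ 1 := pow_le_one₀ hτ0.le hτ1.le
    simp only [hs]; nlinarith
  have hind : ∀ k : ℕ, f (ρ / 2) ≤ θ ^ k * f (s k) +
      b * (2 / (1 - τ)) ^ p * ∑ i ∈ Finset.range k, q ^ i := by
    intro k
    induction k with
    | zero =>
      have : s 0 = ρ / 2 := by simp only [hs]; ring
      simp [this]
    | succ k ih =>
      have hτk : 0 < τ ^ k := pow_pos hτ0 k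
      have hpos : 0 < s (k + 1) - s k := by rw [hstep]; positivity
      have h1 := hf (s k) (s (k + 1)) (hs_ge k) (by linarith) (hs_le _)
      have e : (ρ / (s (k + 1) - s k)) ^ p = (2 / (1 - τ)) ^ p / (τ ^ p) ^ k := by
        rw [hstep, ← pow_mul, mul_comm p k, pow_mul, ← div_pow]
        congr 1
        field_simp
      rw [e] at h1
      have h2 := mul_le_mul_of_nonneg_left h1 (pow_nonneg hθ0 k)
      have e2 : θ ^ k * (b * ((2 / (1 - τ)) ^ p / (τ ^ p) ^ k)) =
          b * (2 / (1 - τ)) ^ p * q ^ k := by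
        rw [hq, div_pow]; ring
      rw [mul_add, e2] at h2
      rw [Finset.sum_range_succ, mul_add, pow_succ]
      linarith
  have hgeom : ∀ k : ℕ, ∑ i ∈ Finset.range k, q ^ i ≤ (1 - q)⁻¹ := fun k => by
    rw [← tsum_geometric_of_lt_one hq0 hq1]
    exact (summable_geometric_of_lt_one hq0 hq1).sum_le_tsum _ fun i _ => pow_nonneg hq0 i
  have hbound : ∀ k : ℕ, f (ρ / 2) ≤ θ ^ k * f ρ + (2 / (1 - τ)) ^ p * (1 - q)⁻¹ * b := by
    intro k
    refine (hind k).trans (add_le_add ?_ ?_)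
    · exact mul_le_mul_of_nonneg_left (hmono _ (hs_le k)) (pow_nonneg hθ0 k)
    · calc _ ≤ b * (2 / (1 - τ)) ^ p * (1 - q)⁻¹ := by gcongr; exact hgeom k
        _ = _ := by ring
  have hlim : Tendsto (fun k : ℕ => θ ^ k * f ρ + (2 / (1 - τ)) ^ p * (1 - q)⁻¹ * b) atTop
      (𝓝 (0 * f ρ + (2 / (1 - τ)) ^ p * (1 - q)⁻¹ * b)) :=
    ((tendsto_pow_atTop_nhds_zero_of_lt_one hθ0 hθ1).mul_const _).add_const _
  rw [zero_mul, zero_add] at hlim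
  exact ge_of_tendsto' hlim hbound

section bounds

variable {n d : ℕ} {h : ℝ → ℝ≥0∞} {U E : Set (EuclideanSpace ℝ (Fin n))}

/-- Rewriting of a one-step comparison in terms of the real-valued measures of two balls. -/
lemma toReal_measure_le_of_annulus (hE : IsSlidingAlmostMinimal d h univ U E) (hU : IsOpen U)
    {x₀ : EuclideanSpace ℝ (Fin n)} {s t ρ A P η : ℝ} (hA : 0 ≤ A) (hP : 0 ≤ P) (hη : 0 ≤ η)
    (hρ : 0 < ρ) (hst : s ≤ t) (htρ : t ≤ ρ) (hBU : Metric.closedBall x₀ ρ ⊆ U)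
    (hh : h ρ / hausdorffRatio d ≤ ENNReal.ofReal η)
    (hle : μH[(d : ℕ)] (E ∩ Metric.closedBall x₀ s) ≤ ENNReal.ofReal A +
      ENNReal.ofReal P * μH[(d : ℕ)]
        (E ∩ (Metric.closedBall x₀ t \ Metric.closedBall x₀ s)) +
      h ρ / hausdorffRatio d * ENNReal.ofReal (ρ ^ d)) :
    (μH[(d : ℕ)] (E ∩ Metric.closedBall x₀ s)).toReal ≤
      P / (1 + P) * (μH[(d : ℕ)] (E ∩ Metric.closedBall x₀ t)).toReal + (A + η * ρ ^ d) := by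
  have hfin : ∀ u ≤ ρ, μH[(d : ℕ)] (E ∩ Metric.closedBall x₀ u) ≠ ⊤ := fun u hu =>
    (hE.hausdorffMeasure_lt_top (isCompact_closedBall x₀ u)
      ((Metric.closedBall_subset_closedBall hu).trans hBU)).ne
  have hsub : E ∩ Metric.closedBall x₀ s ⊆ E ∩ Metric.closedBall x₀ t :=
    inter_subset_inter_right _ (Metric.closedBall_subset_closedBall hst)
  have hm : MeasurableSet (E ∩ Metric.closedBall x₀ s) :=
    (hE.measurableSet hU).inter Metric.isClosed_closedBall.measurableSet
  have e : E ∩ (Metric.closedBall x₀ t \ Metric.closedBall x₀ s) =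
      (E ∩ Metric.closedBall x₀ t) \ (E ∩ Metric.closedBall x₀ s) := by
    ext x; simp only [mem_inter_iff, Set.mem_sdiff]; tauto
  rw [e, measure_sdiff hsub hm.nullMeasurableSet (hfin s (hst.trans htρ))] at hle
  set a := μH[(d : ℕ)] (E ∩ Metric.closedBall x₀ s) with ha
  set b := μH[(d : ℕ)] (E ∩ Metric.closedBall x₀ t) with hb
  have hab : a ≤ b := measure_mono hsub
  have hbt : b ≠ ⊤ := hfin t htρ
  have hat : a ≠ ⊤ := hfin s (hst.trans htρ)
  have h1 : a ≤ ENNReal.ofReal (A + P * (b.toReal - a.toReal) + η * ρ ^ d) := by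
    have hba : 0 ≤ b.toReal - a.toReal := sub_nonneg.2 (ENNReal.toReal_mono hbt hab)
    rw [ENNReal.ofReal_add (by positivity) (by positivity), ENNReal.ofReal_add hA (by positivity),
      ENNReal.ofReal_mul hP, ENNReal.ofReal_mul hη]
    refine hle.trans (add_le_add (add_le_add le_rfl (mul_le_mul' le_rfl ?_)) ?_)
    · rw [← ENNReal.toReal_sub_of_le hab hbt, ENNReal.ofReal_toReal (ENNReal.sub_ne_top hbt)]
    · gcongr
  have h2 : a.toReal ≤ A + P * (b.toReal - a.toReal) + η * ρ ^ d := by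
    have hba : 0 ≤ b.toReal - a.toReal := sub_nonneg.2 (ENNReal.toReal_mono hbt hab)
    exact ENNReal.toReal_le_of_le_ofReal (by positivity) h1
  have h3 : 0 ≤ A + η * ρ ^ d := by positivity
  have h4 : a.toReal * (1 + P) ≤ P * b.toReal + (A + η * ρ ^ d) * (1 + P) := by
    nlinarith [mul_nonneg h3 hP]
  have e5 : P / (1 + P) * b.toReal + (A + η * ρ ^ d) =
      (P * b.toReal + (A + η * ρ ^ d) * (1 + P)) / (1 + P) := by field_simp
  rw [e5, le_div_iff₀ (by linarith)]
  exact h4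

/-- Upper Ahlfors regularity in the ball of half the radius. The mesh in the step from `s` to `t` is
proportional to `t - s`. -/
lemma exists_hausdorffMeasure_le (n d : ℕ) (hd : d ≤ n) :
    ∃ C : ℝ, 0 ≤ C ∧ ∀ (h : ℝ → ℝ≥0∞) (U E : Set (EuclideanSpace ℝ (Fin n))), IsOpen U →
      IsSlidingAlmostMinimal d h univ U E → ∀ (x₀ : EuclideanSpace ℝ (Fin n)) (ρ : ℝ), 0 < ρ →
      Metric.closedBall x₀ ρ ⊆ U → h ρ / hausdorffRatio d ≤ ENNReal.ofReal 1 →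
      μH[(d : ℕ)] (E ∩ Metric.closedBall x₀ (ρ / 2)) ≤ ENNReal.ofReal (C * ρ ^ d) := by
  set P := 2 * pushConst n d with hP
  have hP0 : 0 ≤ P := mul_nonneg (by norm_num) (pushConst_nonneg n d)
  have hθ0 : 0 ≤ P / (1 + P) := by positivity
  have hθ1 : P / (1 + P) < 1 := by rw [div_lt_one (by linarith)]; linarith
  obtain ⟨C, hC, hit⟩ := exists_iteration_bound hθ0 hθ1 n
  set N : ℝ := 2 * n + 1 with hN
  have hN1 : 1 ≤ N := by rw [hN]; linarith [Nat.cast_nonneg (α := ℝ) n]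
  set B : ℝ := (14 * N) ^ n * (n : ℝ) ^ d + 1 with hB
  have hB0 : 0 ≤ B := by positivity
  refine ⟨C * B, by positivity, fun h U E hU hE x₀ ρ hρ hBU hh => ?_⟩
  set f : ℝ → ℝ := fun s => (μH[(d : ℕ)] (E ∩ Metric.closedBall x₀ s)).toReal with hf
  have hfin : ∀ u ≤ ρ, μH[(d : ℕ)] (E ∩ Metric.closedBall x₀ u) ≠ ⊤ := fun u hu =>
    (hE.hausdorffMeasure_lt_top (isCompact_closedBall x₀ u)
      ((Metric.closedBall_subset_closedBall hu).trans hBU)).ne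
  have hmono : ∀ s ≤ ρ, f s ≤ f ρ := fun s hs => ENNReal.toReal_mono (hfin ρ le_rfl)
    (measure_mono (inter_subset_inter_right _ (Metric.closedBall_subset_closedBall hs)))
  have hstep : ∀ s t, ρ / 2 ≤ s → s < t → t ≤ ρ →
      f s ≤ P / (1 + P) * f t + (B * ρ ^ d) * (ρ / (t - s)) ^ n := by
    intro s t hs hst ht
    have hts : 0 < t - s := by linarith
    have hs0 : 0 ≤ s := by linarith
    set δ := (t - s) / N with hδ
    have hδ0 : 0 < δ := by positivity
    have hsδ : s + (2 * n + 1) * δ = t := by rw [hδ, ← hN]; field_simp; ring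
    have hle := hE.measure_le_skeleton_add hU hd (x₀ := x₀) (s := s) hδ0 hs0
      (hsδ.le.trans ht) hBU
    rw [hsδ] at hle
    refine (toReal_measure_le_of_annulus hE hU (by positivity) hP0 zero_le_one hρ hst.le ht hBU hh
      hle).trans ?_
    refine add_le_add le_rfl ?_
    have hr1 : 1 ≤ ρ / (t - s) := by rw [le_div_iff₀ hts]; linarith
    have hδρ : ρ / δ = N * (ρ / (t - s)) := by rw [hδ]; field_simp
    have hδle : δ ≤ ρ := by
      rw [hδ, div_le_iff₀ (by linarith)]; nlinarith
    have h1 : 2 * (s / δ + 1) + 3 ≤ 7 * (ρ / δ) := by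
      have h2 : s / δ ≤ ρ / δ := by gcongr; linarith
      have h3 : 1 ≤ ρ / δ := by rw [le_div_iff₀ hδ0]; linarith
      linarith
    have h0 : 0 ≤ 2 * (s / δ + 1) + 3 := by
      have : 0 ≤ s / δ := div_nonneg (by linarith) hδ0.le
      linarith
    have h4 : 2 ^ n * (2 * (s / δ + 1) + 3) ^ n * (n * δ) ^ d ≤
        (14 * N) ^ n * (n : ℝ) ^ d * ρ ^ d * (ρ / (t - s)) ^ n := by
      calc _ ≤ 2 ^ n * (7 * (ρ / δ)) ^ n * (n * ρ) ^ d := by gcongr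
        _ = _ := by
          rw [hδρ, mul_pow (n : ℝ), ← mul_pow 2, show 2 * (7 * (N * (ρ / (t - s)))) =
            14 * N * (ρ / (t - s)) by ring, mul_pow (14 * N)]
          ring
    have h5 : 1 * ρ ^ d ≤ ρ ^ d * (ρ / (t - s)) ^ n := by
      rw [one_mul]; exact le_mul_of_one_le_right (by positivity) (one_le_pow₀ hr1)
    rw [hB]
    calc _ ≤ (14 * N) ^ n * (n : ℝ) ^ d * ρ ^ d * (ρ / (t - s)) ^ n +
          ρ ^ d * (ρ / (t - s)) ^ n := add_le_add h4 h5
      _ = _ := by ring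
  have hfinal := hit f ρ (B * ρ ^ d) hρ (by positivity) hmono hstep
  rw [← ENNReal.ofReal_toReal (hfin (ρ / 2) (by linarith))]
  apply ENNReal.ofReal_le_ofReal
  rw [mul_assoc]; exact hfinal

/-! ### Lower bound by decay of the density -/

/-- If the density of `E` in a ball is small, then it is no larger in the ball of half the radius:
iterate the annulus estimate on a fixed number of thin annuli. -/
lemma exists_density_decay (n d : ℕ) (hd : d + 1 ≤ n) :
    ∃ c ε : ℝ, 0 < c ∧ c ≤ (1 / 2) ^ (d + 1) / 2 ∧ 0 < ε ∧
      ∀ (h : ℝ → ℝ≥0∞) (U E : Set (EuclideanSpace ℝ (Fin n))), IsOpen U →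
      IsSlidingAlmostMinimal (d + 1) h univ U E → ∀ (x₀ : EuclideanSpace ℝ (Fin n)) (ρ : ℝ), 0 < ρ →
      Metric.closedBall x₀ ρ ⊆ U → h ρ / hausdorffRatio (d + 1) ≤ ENNReal.ofReal ε →
      μH[(d + 1 : ℕ)] (E ∩ Metric.closedBall x₀ ρ) ≤ ENNReal.ofReal (c * ρ ^ (d + 1)) →
      μH[(d + 1 : ℕ)] (E ∩ Metric.closedBall x₀ (ρ / 2)) ≤
        ENNReal.ofReal (c * (ρ / 2) ^ (d + 1)) := by
  set P := 2 * pushConst n (d + 1) with hP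
  have hP0 : 0 ≤ P := mul_nonneg (by norm_num) (pushConst_nonneg n (d + 1))
  set θ := P / (1 + P) with hθ
  have hθ0 : 0 ≤ θ := by positivity
  have hθ1 : θ < 1 := by rw [hθ, div_lt_one (by linarith)]; linarith
  set κ : ℝ := (1 / 2) ^ (d + 1) / 2 with hκ
  have hκ0 : 0 < κ := by positivity
  obtain ⟨K, hK⟩ := exists_pow_lt_of_lt_one hκ0 hθ1
  -- `K + 1` annuli, so that their number is positive
  set L : ℝ := K + 1 with hL
  have hL0 : 0 < L := by positivity
  set N : ℝ := 2 * n + 1 with hN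
  have hN0 : 0 < N := by positivity
  set c₁ : ℝ := (2 * (2 ^ n * (8 * L * N) ^ (d + 1)))⁻¹ with hc₁
  have hc₁0 : 0 < c₁ := by positivity
  set c := min c₁ κ with hc
  have hc0 : 0 < c := lt_min hc₁0 hκ0
  refine ⟨c, c * κ / L, hc0, min_le_right _ _, by positivity,
    fun h U E hU hE x₀ ρ hρ hBU hh hsmall => ?_⟩
  set f : ℝ → ℝ := fun s => (μH[(d + 1 : ℕ)] (E ∩ Metric.closedBall x₀ s)).toReal with hf
  have hfin : ∀ u ≤ ρ, μH[(d + 1 : ℕ)] (E ∩ Metric.closedBall x₀ u) ≠ ⊤ := fun u hu =>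
    (hE.hausdorffMeasure_lt_top (isCompact_closedBall x₀ u)
      ((Metric.closedBall_subset_closedBall hu).trans hBU)).ne
  set δ := ρ / (2 * L * N) with hδ
  have hδ0 : 0 < δ := by positivity
  have hsm : ENNReal.ofReal (2 ^ n * (4 * δ⁻¹) ^ (d + 1)) *
      μH[(d + 1 : ℕ)] (E ∩ Metric.closedBall x₀ ρ) ≤ 2⁻¹ := by
    refine (mul_le_mul' le_rfl hsmall).trans ?_
    rw [← ENNReal.ofReal_mul (by positivity)]
    have e : (2 ^ n * (4 * δ⁻¹) ^ (d + 1)) * (c * ρ ^ (d + 1)) =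
        2 ^ n * (8 * L * N) ^ (d + 1) * c := by
      have e1 : 4 * δ⁻¹ * ρ = 8 * L * N := by rw [hδ]; field_simp; ring
      rw [← e1, mul_pow (4 * δ⁻¹) ρ]; ring
    have e2 : (2⁻¹ : ℝ≥0∞) = ENNReal.ofReal (1 / 2) := by
      rw [one_div, ENNReal.ofReal_inv_of_pos (by norm_num), ENNReal.ofReal_ofNat]
    rw [e, e2]
    apply ENNReal.ofReal_le_ofReal
    calc _ ≤ 2 ^ n * (8 * L * N) ^ (d + 1) * c₁ := by gcongr; exact min_le_left _ _
      _ = _ := by rw [hc₁]; field_simp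
  set s : ℕ → ℝ := fun k => ρ / 2 + k * (ρ / (2 * L)) with hs
  have hLs : L * (ρ / (2 * L)) = ρ / 2 := by field_simp
  have hstep : ∀ k : ℕ, k < K + 1 →
      f (s k) ≤ θ * f (s (k + 1)) + c * κ / L * ρ ^ (d + 1) := by
    intro k hk
    have hk' : ((k + 1 : ℕ) : ℝ) ≤ L := by rw [hL]; exact_mod_cast hk
    have hle1 : s (k + 1) ≤ ρ := by
      have : ((k + 1 : ℕ) : ℝ) * (ρ / (2 * L)) ≤ L * (ρ / (2 * L)) := by gcongr
      simp only [hs]; linarith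
    have hss : s k + (2 * n + 1) * δ = s (k + 1) := by
      simp only [hs]; rw [hδ, ← hN]; push_cast; field_simp; ring
    have hle := hE.measure_le_annulus_add hU hd (x₀ := x₀) (s := s k) hδ0 (by positivity)
      (hss.le.trans hle1) hBU hsm
    rw [hss] at hle
    have hle2 : s k ≤ s (k + 1) := by rw [← hss]; exact le_add_of_nonneg_right (by positivity)
    have h1 := toReal_measure_le_of_annulus hE hU (A := 0) le_rfl hP0
      (η := c * κ / L) (by positivity) hρ hle2 hle1 hBU hh
      (by rw [ENNReal.ofReal_zero, zero_add]; exact hle)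
    rw [zero_add] at h1
    exact h1
  have hind : ∀ k : ℕ, k ≤ K + 1 →
      f (s 0) ≤ θ ^ k * f (s k) + k * (c * κ / L * ρ ^ (d + 1)) := by
    intro k
    induction k with
    | zero => intro _; simp
    | succ k ih =>
      intro hk
      have h1 := ih (by omega)
      have h2 := mul_le_mul_of_nonneg_left (hstep k (by omega)) (pow_nonneg hθ0 k)
      have h3 : θ ^ k * (c * κ / L * ρ ^ (d + 1)) ≤ c * κ / L * ρ ^ (d + 1) :=
        mul_le_of_le_one_left (by positivity) (pow_le_one₀ hθ0 hθ1.le)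
      rw [pow_succ]; push_cast
      rw [mul_add] at h2
      linarith
  have hmain := hind (K + 1) le_rfl
  have hs0 : s 0 = ρ / 2 := by simp [hs]
  have hsK : s (K + 1) = ρ := by simp only [hs]; push_cast; rw [← hL, hLs]; ring
  have hfρ : f ρ ≤ c * ρ ^ (d + 1) := ENNReal.toReal_le_of_le_ofReal (by positivity) hsmall
  have hfρ0 : 0 ≤ f ρ := ENNReal.toReal_nonneg
  rw [hs0, hsK] at hmain
  have hpow : θ ^ (K + 1) ≤ κ :=
    (pow_le_pow_of_le_one hθ0 hθ1.le (Nat.le_succ K)).trans hK.le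
  have h4 : θ ^ (K + 1) * f ρ ≤ κ * (c * ρ ^ (d + 1)) := by gcongr
  have h5 : ((K + 1 : ℕ) : ℝ) * (c * κ / L * ρ ^ (d + 1)) = κ * (c * ρ ^ (d + 1)) := by
    push_cast; rw [← hL]; field_simp
  have h6 : κ * (c * ρ ^ (d + 1)) + κ * (c * ρ ^ (d + 1)) = c * (ρ / 2) ^ (d + 1) := by
    rw [hκ, div_pow ρ 2, div_pow 1 2, one_pow]; ring
  rw [← ENNReal.ofReal_toReal (hfin (ρ / 2) (by linarith))]
  apply ENNReal.ofReal_le_ofReal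
  calc f (ρ / 2) ≤ _ := hmain
    _ ≤ _ := by rw [h5, ← h6]; linarith

/-- A set of finite measure whose density is at most `1/2` at all small scales is negligible: sum
the density bound over a nearly optimal covering. -/
lemma hausdorffMeasure_eq_zero_of_density_le {X : Type*} [MetricSpace X] [MeasurableSpace X]
    [BorelSpace X] {d : ℕ} {S : Set X} (hfin : μH[(d + 1 : ℕ)] S ≠ ⊤) {r₀ : ℝ} (hr₀ : 0 < r₀)
    (hS : ∀ y ∈ S, ∀ r, 0 < r → r ≤ r₀ →
      μH[(d + 1 : ℕ)] (S ∩ Metric.closedBall y r) ≤ 2⁻¹ * ENNReal.ofReal r ^ (d + 1)) :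
    μH[(d + 1 : ℕ)] S = 0 := by
  have key : 2 * μH[(d + 1 : ℕ)] S ≤ μH[(d + 1 : ℕ)] S := by
    nth_rw 2 [Measure.hausdorffMeasure_apply]
    refine le_trans ?_ (le_iSup₂ (ENNReal.ofReal r₀) (ENNReal.ofReal_pos.2 hr₀))
    refine le_iInf fun T => le_iInf fun hT => le_iInf fun hd => ?_
    have h1 : μH[(d + 1 : ℕ)] S ≤ ∑' l, μH[(d + 1 : ℕ)] (S ∩ T l) := by
      refine le_trans (measure_mono ?_) (measure_iUnion_le _)
      rw [← inter_iUnion]; exact fun x hx => ⟨hx, hT hx⟩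
    refine (mul_le_mul' le_rfl h1).trans ?_
    rw [← ENNReal.tsum_mul_left]
    refine ENNReal.tsum_le_tsum fun l => ?_
    rcases (S ∩ T l).eq_empty_or_nonempty with hemp | ⟨y, hyS, hyT⟩
    · rw [hemp, measure_empty, mul_zero]; exact bot_le
    · rw [ciSup_pos ⟨y, hyT⟩, ENNReal.rpow_natCast]
      have hdl := hd l
      have hdt : Metric.ediam (T l) ≠ ⊤ := ne_top_of_le_ne_top ENNReal.ofReal_ne_top hdl
      rcases eq_or_ne (Metric.ediam (T l)) 0 with h0 | h0
      · have hsub : S ∩ T l ⊆ {y} := fun z hz =>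
          Metric.ediam_eq_zero_iff.1 h0 hz.2 hyT
        have := Measure.nullSingletonClass_hausdorff X
          (d := ((d + 1 : ℕ) : ℝ)) (by positivity)
        have hz : μH[(d + 1 : ℕ)] (S ∩ T l) = 0 := measure_mono_null hsub (measure_singleton y)
        rw [hz, mul_zero]; exact bot_le
      · have hpos : 0 < (Metric.ediam (T l)).toReal := ENNReal.toReal_pos h0 hdt
        have hsub : S ∩ T l ⊆ S ∩ Metric.closedBall y (Metric.ediam (T l)).toReal := by
          rintro z ⟨hzS, hzT⟩
          refine ⟨hzS, ?_⟩
          rw [Metric.mem_closedBall, dist_edist]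
          exact ENNReal.toReal_mono hdt (Metric.edist_le_ediam_of_mem hzT hyT)
        have h2 := (measure_mono hsub).trans (hS y hyS _ hpos
          (ENNReal.toReal_le_of_le_ofReal hr₀.le hdl))
        rw [ENNReal.ofReal_toReal hdt] at h2
        refine (mul_le_mul' le_rfl h2).trans_eq ?_
        rw [← mul_assoc, ENNReal.mul_inv_cancel (by norm_num) (by norm_num), one_mul]
  rw [two_mul] at key
  by_contra h0
  exact absurd key (not_le.2 (ENNReal.lt_add_right hfin h0))

/-- Lower Ahlfors regularity in positive dimension. -/
lemma exists_le_hausdorffMeasure (n d : ℕ) (hd : d + 1 ≤ n) :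
    ∃ c ε : ℝ, 0 < c ∧ 0 < ε ∧
      ∀ (h : ℝ → ℝ≥0∞) (U E : Set (EuclideanSpace ℝ (Fin n))), IsOpen U → IsGauge h →
      IsSlidingAlmostMinimal (d + 1) h univ U E → IsCoral (d + 1) E → ∀ x ∈ E, ∀ r : ℝ, 0 < r →
      Metric.ball x (2 * r) ⊆ U → h r / hausdorffRatio (d + 1) ≤ ENNReal.ofReal ε →
      ENNReal.ofReal (c * r ^ (d + 1)) ≤ μH[(d + 1 : ℕ)] (E ∩ Metric.ball x r) := by
  obtain ⟨c, ε, hc, hc2, hε, hdecay⟩ := exists_density_decay n d hd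
  refine ⟨c * (1 / 2) ^ (d + 1), ε, by positivity, hε,
    fun h U E hU hh hE hcoral x hx r hr hBU hhr => ?_⟩
  by_contra! hlt
  have hr2 : 0 < r / 2 := by positivity
  have hball : ∀ y ∈ Metric.ball x (r / 2), Metric.closedBall y (r / 2) ⊆ Metric.ball x r := by
    intro y hy z hz
    rw [Metric.mem_ball] at hy ⊢
    rw [Metric.mem_closedBall] at hz
    linarith [dist_triangle z y x]
  have hrU : Metric.ball x r ⊆ U := (Metric.ball_subset_ball (by linarith)).trans hBU
  have hdy : ∀ y ∈ Metric.ball x (r / 2), ∀ k : ℕ,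
      μH[(d + 1 : ℕ)] (E ∩ Metric.closedBall y (r / 2 * (1 / 2) ^ k)) ≤
        ENNReal.ofReal (c * (r / 2 * (1 / 2) ^ k) ^ (d + 1)) := by
    intro y hy k
    induction k with
    | zero =>
      rw [pow_zero, mul_one]
      refine (measure_mono (inter_subset_inter_right _ (hball y hy))).trans (hlt.le.trans_eq ?_)
      rw [div_eq_mul_one_div r 2, mul_pow]; ring_nf
    | succ k ih =>
      have hk0 : (0 : ℝ) < r / 2 * (1 / 2) ^ k := by positivity
      have hk1 : r / 2 * (1 / 2) ^ k ≤ r / 2 :=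
        mul_le_of_le_one_right hr2.le (pow_le_one₀ (by norm_num) (by norm_num))
      have e : r / 2 * (1 / 2) ^ (k + 1) = r / 2 * (1 / 2) ^ k / 2 := by rw [pow_succ]; ring
      rw [e]
      refine hdecay h U E hU hE y _ hk0 (((Metric.closedBall_subset_closedBall hk1).trans
        (hball y hy)).trans hrU) ?_ ih
      refine le_trans (ENNReal.div_le_div_right ?_ _) hhr
      exact hh.monotoneOn (mem_Ioi.2 hk0) (mem_Ioi.2 hr) (by linarith)
  set S := E ∩ Metric.ball x (r / 2) with hS
  have hSfin : μH[(d + 1 : ℕ)] S ≠ ⊤ :=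
    ((measure_mono (inter_subset_inter_right _ (Metric.ball_subset_ball (by linarith)))).trans_lt
      (hlt.trans ENNReal.ofReal_lt_top)).ne
  have hS0 : μH[(d + 1 : ℕ)] S = 0 := by
    refine hausdorffMeasure_eq_zero_of_density_le hSfin hr2 fun y hy ρ hρ hρr => ?_
    obtain ⟨k, hk1, hk2⟩ := exists_nat_pow_near_of_lt_one (x := ρ / (r / 2)) (by positivity)
      ((div_le_one hr2).2 hρr) (show (0 : ℝ) < 1 / 2 by norm_num) (by norm_num)
    rw [lt_div_iff₀ hr2, pow_succ] at hk1
    rw [div_le_iff₀ hr2] at hk2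
    have h1 : S ∩ Metric.closedBall y ρ ⊆
        E ∩ Metric.closedBall y (r / 2 * (1 / 2) ^ k) := fun z hz =>
      ⟨hz.1.1, Metric.closedBall_subset_closedBall (by linarith) hz.2⟩
    refine (measure_mono h1).trans ((hdy y hy.2 k).trans ?_)
    have e2 : (2⁻¹ : ℝ≥0∞) = ENNReal.ofReal (1 / 2) := by
      rw [one_div, ENNReal.ofReal_inv_of_pos (by norm_num), ENNReal.ofReal_ofNat]
    rw [e2, ← ENNReal.ofReal_pow hρ.le, ← ENNReal.ofReal_mul (by norm_num)]
    apply ENNReal.ofReal_le_ofReal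
    have h3 : r / 2 * (1 / 2) ^ k ≤ 2 * ρ := by linarith
    calc c * (r / 2 * (1 / 2) ^ k) ^ (d + 1) ≤ (1 / 2) ^ (d + 1) / 2 * (2 * ρ) ^ (d + 1) :=
          mul_le_mul hc2 (pow_le_pow_left₀ (by positivity) h3 _) (by positivity) (by positivity)
      _ = 1 / 2 * ((1 / 2) ^ (d + 1) * (2 * ρ) ^ (d + 1)) := by ring
      _ = _ := by rw [← mul_pow, show (1 / 2 : ℝ) * (2 * ρ) = ρ by ring]
  have hx' : x ∈ coralCore (d + 1) E := by
    have := hx; rw [hcoral] at this; exact this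
  have := hx'.2 (r / 2) hr2
  rw [euclideanHausdorffMeasure_eq, hS0, mul_zero] at this
  exact lt_irrefl _ this

end bounds

/-! ### Uniform constants and conclusion -/

lemma ofReal_toReal_hausdorffRatio (d : ℕ) :
    ENNReal.ofReal (hausdorffRatio d).toReal = hausdorffRatio d :=
  ENNReal.ofReal_toReal (hausdorffRatio_ne_top d)

lemma toReal_hausdorffRatio_pos (d : ℕ) : 0 < (hausdorffRatio d).toReal :=
  ENNReal.toReal_pos (hausdorffRatio_ne_zero d) (hausdorffRatio_ne_top d)

lemma div_hausdorffRatio_le {d : ℕ} {b : ℝ≥0∞} {ε : ℝ}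
    (h : b ≤ ENNReal.ofReal (ε * (hausdorffRatio d).toReal)) :
    b / hausdorffRatio d ≤ ENNReal.ofReal ε := by
  rw [ENNReal.ofReal_mul' ENNReal.toReal_nonneg, ofReal_toReal_hausdorffRatio] at h
  exact ENNReal.div_le_of_le_mul h

/-- The upper bound in the concentric ball of half the radius, for the normalized measure. -/
lemma exists_upper_bound (n d : ℕ) (hd : d ≤ n) :
    ∃ C ε : ℝ, 1 ≤ C ∧ 0 < ε ∧ ∀ (h : ℝ → ℝ≥0∞) (U E : Set (EuclideanSpace ℝ (Fin n))), IsOpen U →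
      IsPlainAlmostMinimal d h U E → ∀ (x₀ : EuclideanSpace ℝ (Fin n)) (ρ : ℝ), 0 < ρ →
      Metric.closedBall x₀ ρ ⊆ U → h ρ ≤ ENNReal.ofReal ε →
      μHE[d] (E ∩ Metric.closedBall x₀ (ρ / 2)) ≤ ENNReal.ofReal (C * ρ ^ d) := by
  obtain ⟨C, hC, hbound⟩ := exists_hausdorffMeasure_le n d hd
  refine ⟨max 1 ((hausdorffRatio d).toReal * C), 1 * (hausdorffRatio d).toReal, le_max_left _ _,
    by rw [one_mul]; exact toReal_hausdorffRatio_pos d, fun h U E hU hE x₀ ρ hρ hBU hh => ?_⟩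
  rw [euclideanHausdorffMeasure_eq]
  refine (mul_le_mul' le_rfl (hbound h U E hU hE x₀ ρ hρ hBU (div_hausdorffRatio_le hh))).trans ?_
  rw [← ofReal_toReal_hausdorffRatio d, ← ENNReal.ofReal_mul ENNReal.toReal_nonneg, ← mul_assoc]
  apply ENNReal.ofReal_le_ofReal
  rw [ofReal_toReal_hausdorffRatio]
  gcongr
  exact le_max_right _ _

/-- The lower bound, for the normalized measure. In dimension `0` it holds because a point has
measure `1`. -/
lemma exists_lower_bound (n d : ℕ) (hd : d ≤ n) :
    ∃ C ε : ℝ, 1 ≤ C ∧ 0 < ε ∧ ∀ (h : ℝ → ℝ≥0∞) (U E : Set (EuclideanSpace ℝ (Fin n))), IsOpen U →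
      IsGauge h → IsPlainAlmostMinimal d h U E → IsCoral d E → ∀ x ∈ E, ∀ r : ℝ, 0 < r →
      Metric.ball x (2 * r) ⊆ U → h r ≤ ENNReal.ofReal ε →
      ENNReal.ofReal (C⁻¹ * r ^ d) ≤ μHE[d] (E ∩ Metric.ball x r) := by
  rcases d with _ | d
  · refine ⟨1, 1, le_rfl, one_pos, fun h U E _ _ _ _ x hx r hr _ _ => ?_⟩
    rw [Measure.euclideanHausdorffMeasure_zero]
    have hne : (E ∩ Metric.ball x r).Nonempty := ⟨x, hx, Metric.mem_ball_self hr⟩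
    simpa using Measure.one_le_hausdorffMeasure_zero_of_nonempty hne
  · obtain ⟨c, ε, hc, hε, hbound⟩ := exists_le_hausdorffMeasure n d hd
    have hκ := toReal_hausdorffRatio_pos (d + 1)
    refine ⟨max 1 ((hausdorffRatio (d + 1)).toReal * c)⁻¹, ε * (hausdorffRatio (d + 1)).toReal,
      le_max_left _ _, by positivity, fun h U E hU hg hE hcoral x hx r hr hBU hh => ?_⟩
    rw [euclideanHausdorffMeasure_eq]
    refine le_trans ?_ (mul_le_mul' le_rfl
      (hbound h U E hU hg hE hcoral x hx r hr hBU (div_hausdorffRatio_le hh)))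
    nth_rw 2 [← ofReal_toReal_hausdorffRatio (d + 1)]
    rw [← ENNReal.ofReal_mul ENNReal.toReal_nonneg, ← mul_assoc]
    apply ENNReal.ofReal_le_ofReal
    gcongr
    exact inv_le_of_inv_le₀ (by positivity) (le_max_right _ _)

/-- Constants in a family indexed by `d ≤ n` can be chosen independently of `d`. -/
lemma exists_uniform_constants (n : ℕ) {Q : ℕ → ℝ → ℝ → Prop}
    (hmono : ∀ d C C' ε ε', 1 ≤ C → C ≤ C' → ε' ≤ ε → Q d C ε → Q d C' ε')
    (h : ∀ d ≤ n, ∃ C ε : ℝ, 1 ≤ C ∧ 0 < ε ∧ Q d C ε) :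
    ∃ C ε : ℝ, 1 ≤ C ∧ 0 < ε ∧ ∀ d ≤ n, Q d C ε := by
  induction n with
  | zero =>
    obtain ⟨C, ε, hC, hε, hQ⟩ := h 0 le_rfl
    exact ⟨C, ε, hC, hε, fun d hd => by rwa [Nat.le_zero.1 hd]⟩
  | succ n ih =>
    obtain ⟨C, ε, hC, hε, hQ⟩ := ih fun d hd => h d (by omega)
    obtain ⟨C', ε', hC', hε', hQ'⟩ := h (n + 1) le_rfl
    refine ⟨max C C', min ε ε', hC.trans (le_max_left _ _), lt_min hε hε', fun d hd => ?_⟩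
    rcases Nat.le_succ_iff.1 hd with hd | rfl
    · exact hmono d C _ ε _ hC (le_max_left _ _) (min_le_left _ _) (hQ d hd)
    · exact hmono _ C' _ ε' _ hC' (le_max_right _ _) (min_le_right _ _) hQ'

/-- A ball of radius `r` is covered by a number of balls of radius `c r` depending only on `n` and
`c`, centred in the closed ball. -/
lemma exists_cover_ball (n : ℕ) {c : ℝ} (hc : 0 < c) :
    ∃ t : Finset (EuclideanSpace ℝ (Fin n)), ∀ (x : EuclideanSpace ℝ (Fin n)) (r : ℝ), 0 < r →
      (∀ v ∈ t, x + r • v ∈ Metric.closedBall x r) ∧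
        Metric.ball x r ⊆ ⋃ v ∈ t, Metric.closedBall (x + r • v) (c * r) := by
  obtain ⟨t, ht, htfin, hcov⟩ := (isCompact_closedBall (0 : EuclideanSpace ℝ (Fin n))
    1).finite_cover_balls hc
  refine ⟨htfin.toFinset, fun x r hr => ⟨fun v hv => ?_, fun z hz => ?_⟩⟩
  · have h1 := ht (htfin.mem_toFinset.1 hv)
    rw [mem_closedBall_zero_iff] at h1
    rw [Metric.mem_closedBall, dist_self_add_left, norm_smul, Real.norm_of_nonneg hr.le]
    exact mul_le_of_le_one_right hr.le h1
  · rw [Metric.mem_ball, dist_eq_norm] at hz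
    have h1 : r⁻¹ • (z - x) ∈ Metric.closedBall (0 : EuclideanSpace ℝ (Fin n)) 1 := by
      rw [mem_closedBall_zero_iff, norm_smul, norm_inv, Real.norm_of_nonneg hr.le,
        inv_mul_le_iff₀ hr, mul_one]
      exact hz.le
    obtain ⟨v, hv, hvz⟩ := mem_iUnion₂.1 (hcov h1)
    refine mem_iUnion₂.2 ⟨v, htfin.mem_toFinset.2 hv, ?_⟩
    rw [Metric.mem_ball, dist_eq_norm] at hvz
    rw [Metric.mem_closedBall, dist_eq_norm]
    have e : z - (x + r • v) = r • (r⁻¹ • (z - x) - v) := by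
      rw [smul_sub, smul_inv_smul₀ hr.ne']; abel
    rw [e, norm_smul, Real.norm_of_nonneg hr.le, mul_comm]
    gcongr

/-- Both bounds at scale `r`, from the smallness of the gauge at the comparable scale `l r`. -/
lemma exists_regularity_at_scale (n : ℕ) : ∃ ε : ℝ, 0 < ε ∧ ∀ l : ℝ, 0 < l → l ≤ 1 →
    ∃ C : ℝ, 1 ≤ C ∧ ∀ h : ℝ → ℝ≥0∞, IsGauge h → ∀ d : ℕ, d ≤ n →
      ∀ U E : Set (EuclideanSpace ℝ (Fin n)), IsOpen U →
        IsPlainAlmostMinimal d h U E → IsCoral d E →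
        ∀ x ∈ E, ∀ r : ℝ, 0 < r → Metric.ball x (2 * r) ⊆ U → h (l * r) ≤ ENNReal.ofReal ε →
          ENNReal.ofReal (C⁻¹ * r ^ d) ≤ μHE[d] (E ∩ Metric.ball x r) ∧
            μHE[d] (E ∩ Metric.ball x r) ≤ ENNReal.ofReal (C * r ^ d) := by
  obtain ⟨C₁, ε₁, hC₁, hε₁, hup⟩ := exists_uniform_constants n
    (Q := fun d C ε => ∀ (h : ℝ → ℝ≥0∞) (U E : Set (EuclideanSpace ℝ (Fin n))), IsOpen U →
      IsPlainAlmostMinimal d h U E → ∀ (x₀ : EuclideanSpace ℝ (Fin n)) (ρ : ℝ), 0 < ρ →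
      Metric.closedBall x₀ ρ ⊆ U → h ρ ≤ ENNReal.ofReal ε →
      μHE[d] (E ∩ Metric.closedBall x₀ (ρ / 2)) ≤ ENNReal.ofReal (C * ρ ^ d))
    (fun d C C' ε ε' _ hCC hεε hQ h U E hU hE x₀ ρ hρ hBU hh =>
      (hQ h U E hU hE x₀ ρ hρ hBU (hh.trans (ENNReal.ofReal_le_ofReal hεε))).trans
        (ENNReal.ofReal_le_ofReal (by gcongr)))
    (exists_upper_bound n)
  obtain ⟨C₂, ε₂, hC₂, hε₂, hlow⟩ := exists_uniform_constants n
    (Q := fun d C ε => ∀ (h : ℝ → ℝ≥0∞) (U E : Set (EuclideanSpace ℝ (Fin n))), IsOpen U →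
      IsGauge h → IsPlainAlmostMinimal d h U E → IsCoral d E → ∀ x ∈ E, ∀ r : ℝ, 0 < r →
      Metric.ball x (2 * r) ⊆ U → h r ≤ ENNReal.ofReal ε →
      ENNReal.ofReal (C⁻¹ * r ^ d) ≤ μHE[d] (E ∩ Metric.ball x r))
    (fun d C C' ε ε' hC hCC hεε hQ h U E hU hg hE hco x hx r hr hBU hh =>
      (ENNReal.ofReal_le_ofReal (by gcongr)).trans
        (hQ h U E hU hg hE hco x hx r hr hBU (hh.trans (ENNReal.ofReal_le_ofReal hεε))))
    (exists_lower_bound n)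
  refine ⟨min ε₁ ε₂, lt_min hε₁ hε₂, fun l hl hl1 => ?_⟩
  obtain ⟨t, ht⟩ := exists_cover_ball n (c := l / 4) (by positivity)
  have hln : 0 < l ^ n := pow_pos hl n
  refine ⟨max (t.card * C₁) (C₂ / l ^ n), ?_,
    fun h hg d hd U E hU hE hco x hx r hr hBU hh => ⟨?_, ?_⟩⟩
  · refine le_max_of_le_right ?_
    rw [le_div_iff₀ hln, one_mul]
    exact (pow_le_one₀ hl.le hl1).trans hC₂
  · have hlr : 0 < l * r := by positivity
    have hlr' : l * r ≤ r := mul_le_of_le_one_left hr.le hl1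
    have h1 := hlow d hd h U E hU hg hE hco x hx (l * r) hlr
      ((Metric.ball_subset_ball (by linarith)).trans hBU)
      (hh.trans (ENNReal.ofReal_le_ofReal (min_le_right _ _)))
    refine (ENNReal.ofReal_le_ofReal ?_).trans (h1.trans (measure_mono
      (inter_subset_inter_right _ (Metric.ball_subset_ball hlr'))))
    have h2 : l ^ n ≤ l ^ d := pow_le_pow_of_le_one hl.le hl1 hd
    have h3 : (max (t.card * C₁) (C₂ / l ^ n))⁻¹ ≤ C₂⁻¹ * l ^ d := by
      calc _ ≤ (C₂ / l ^ n)⁻¹ := inv_anti₀ (by positivity) (le_max_right _ _)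
        _ = C₂⁻¹ * l ^ n := by rw [inv_div, div_eq_inv_mul]
        _ ≤ _ := by gcongr
    rw [mul_pow, ← mul_assoc]
    gcongr
  · obtain ⟨hcen, hcov⟩ := ht x r hr
    have hρ : 0 < l * r / 2 := by positivity
    have hlr' : l * r ≤ r := mul_le_of_le_one_left hr.le hl1
    have hsub : E ∩ Metric.ball x r ⊆
        ⋃ v ∈ t, E ∩ Metric.closedBall (x + r • v) (l * r / 2 / 2) := by
      rintro z ⟨hzE, hz⟩
      obtain ⟨v, hv, hzv⟩ := mem_iUnion₂.1 (hcov hz)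
      refine mem_iUnion₂.2 ⟨v, hv, hzE, ?_⟩
      rwa [show l * r / 2 / 2 = l / 4 * r by ring]
    have hg' : h (l * r / 2) ≤ ENNReal.ofReal ε₁ :=
      (hg.monotoneOn (mem_Ioi.2 hρ) (mem_Ioi.2 (by positivity)) (by linarith)).trans
        (hh.trans (ENNReal.ofReal_le_ofReal (min_le_left _ _)))
    calc _ ≤ ∑ v ∈ t, μHE[d] (E ∩ Metric.closedBall (x + r • v) (l * r / 2 / 2)) :=
          (measure_mono hsub).trans (measure_biUnion_finset_le _ _)
      _ ≤ ∑ v ∈ t, ENNReal.ofReal (C₁ * r ^ d) := by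
          refine Finset.sum_le_sum fun v hv => ?_
          refine (hup d hd h U E hU hE _ _ hρ ?_ hg').trans (ENNReal.ofReal_le_ofReal ?_)
          · refine fun z hz => hBU ?_
            have h1 := Metric.mem_closedBall.1 (hcen v hv)
            rw [Metric.mem_closedBall] at hz
            rw [Metric.mem_ball]
            linarith [dist_triangle z (x + r • v) x]
          · gcongr; linarith
      _ = ENNReal.ofReal (t.card * C₁ * r ^ d) := by
          rw [Finset.sum_const, nsmul_eq_mul, mul_assoc,
            ENNReal.ofReal_mul (p := (t.card : ℝ)) (by positivity), ENNReal.ofReal_natCast]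
      _ ≤ _ := by
          apply ENNReal.ofReal_le_ofReal
          gcongr
          exact le_max_left _ _

theorem theorem4p2 (n : ℕ) :
    -- the constant depends only on `n` and `h`
    (∀ h : ℝ → ℝ≥0∞, IsGauge h →
      ∃ C : ℝ, 1 ≤ C ∧
        ∀ d : ℕ, d ≤ n →
        ∀ U E : Set (EuclideanSpace ℝ (Fin n)), IsOpen U →
          IsPlainAlmostMinimal d h U E → IsCoral d E →
          ∀ x ∈ E, ∀ r ∈ Ioo (0 : ℝ) 1, Metric.ball x (2 * r) ⊆ U →
            ENNReal.ofReal (C⁻¹ * r ^ d) ≤ μHE[d] (E ∩ Metric.ball x r) ∧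
              μHE[d] (E ∩ Metric.ball x r) ≤ ENNReal.ofReal (C * r ^ d)) ∧
    -- the constant depends only on `n` when `h r` is small enough, depending on `n`
    (∃ C : ℝ, 1 ≤ C ∧ ∃ ε : ℝ, 0 < ε ∧
      ∀ h : ℝ → ℝ≥0∞, IsGauge h →
        ∀ d : ℕ, d ≤ n →
        ∀ U E : Set (EuclideanSpace ℝ (Fin n)), IsOpen U →
          IsPlainAlmostMinimal d h U E → IsCoral d E →
          ∀ x ∈ E, ∀ r ∈ Ioo (0 : ℝ) 1, Metric.ball x (2 * r) ⊆ U →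
            h r ≤ ENNReal.ofReal ε →
            ENNReal.ofReal (C⁻¹ * r ^ d) ≤ μHE[d] (E ∩ Metric.ball x r) ∧
              μHE[d] (E ∩ Metric.ball x r) ≤ ENNReal.ofReal (C * r ^ d)) := by
  obtain ⟨ε, hε, hreg⟩ := exists_regularity_at_scale n
  refine ⟨fun h hg => ?_, ?_⟩
  · -- the gauge is at most `ε` on some interval `(0, l]`
    have h1 : ∀ᶠ l in 𝓝[>] (0 : ℝ), h l ≤ ENNReal.ofReal ε :=
      hg.tendsto_zero.eventually (ge_mem_nhds (ENNReal.ofReal_pos.2 hε))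
    have h2 : ∀ᶠ l in 𝓝[>] (0 : ℝ), l ∈ Ioo (0 : ℝ) 1 := Ioo_mem_nhdsGT one_pos
    obtain ⟨l, hl, hl0, hl1⟩ := (h1.and h2).exists
    obtain ⟨C, hC, hCreg⟩ := hreg l hl0 hl1.le
    refine ⟨C, hC, fun d hd U E hU hE hco x hx r hr hBU =>
      hCreg h hg d hd U E hU hE hco x hx r hr.1 hBU (le_trans ?_ hl)⟩
    exact hg.monotoneOn (mem_Ioi.2 (mul_pos hl0 hr.1)) (mem_Ioi.2 hl0)
      (mul_le_of_le_one_right hl0.le hr.2.le)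
  · obtain ⟨C, hC, hCreg⟩ := hreg 1 one_pos le_rfl
    refine ⟨C, hC, ε, hε, fun h hg d hd U E hU hE hco x hx r hr hBU hh =>
      hCreg h hg d hd U E hU hE hco x hx r hr.1 hBU (by rwa [one_mul])⟩
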